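/- **Theorem (Landscape analysis).** Notation. Let $\mathbb T=\mathbb R/2\pi\mathbb Z$ with distance $|u-v|=\min_{n\in\mathbb Z}|u-v+2\pi n|$; functions on $\mathbb T$ are regarded as $2\pi$-periodic functions on $\mathbb R$. For a positive integer $m$ let $I(m)=\{-\frac{m-1}{2},-\frac{m-3}{2},\dots,\frac{m-1}{2}\}$ and $\phi(t)=\frac1{\sqrt m}\,[e^{ikt}]_{k\in I(m)}\in\mathbb C^m$. For $x=\{x_1,\dots,x_s\}\subset\mathbb T$ let $\Delta(x)=\min_{j\neq k}|x_j-x_k|$ (with $\Delta(x)=\infty$ if $s\le 1$), and let $U_x\subset\mathbb C^m$ be the range of the $m\times s$ Fourier matrix $\Phi(m,x)=[e^{ikx_j}]_{k\in I(m),\,1\le j\le s}$. For a subspace $W\subset\mathbb C^m$ let $P_W$ be the orthogonal projection onto $W$, let $q_W(t)=1-\|P_W\phi(t)\|_2^2$ be its landscape function, and let $\vartheta(x,W)=\|P_{U_x}-P_W\|_2$ (spectral norm) be the sine-theta distance between $U_x$ and $W$. Let $m\ge 100$. Let $x=\{x_j\}_{j=1}^s\subset\mathbb T$ satisfy $\Delta(x)\ge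 8\pi/m$, and let $\tilde U\subset\mathbb C^m$ be any $s$-dimensional complex subspace with $\vartheta:=\vartheta(x,\tilde U)\le 0.01$. Then $\tilde q:=q_{\tilde U}$ has at least $s$ critical points: there are $s$ distinct critical points $\tilde x_1,\dots,\tilde x_s\in\mathbb T$ of $\tilde q$ such that the following hold for each $j\in\{1,\dots,s\}$ (where in (e) no single $j$ is involved). (a) $|\tilde x_j-x_j|\le \dfrac{7\vartheta}{m}$. (b) $0.0271\,m^2\le \tilde q''(t)\le 0.269\,m^2$ for all $t\in[\tilde x_j-\frac{\pi}{3m},\,\tilde x_j+\frac{\pi}{3m}]$. (c) $\tilde x_j$ is a local minimum of $\tilde q$, and $\tilde q(\tilde x_j)\le\tilde q(x_j)\le\vartheta^2\le 10^{-4}$. (d) $\tilde q'(t)\ge 0.0306\,m$ for all $t\in[\tilde x_j+\frac{\pi}{3m},\,\tilde x_j+\frac{4\pi}{3m}]$, and $\tilde q'(t)\le -0.0306\,m$ for all $t\in[\tilde x_j-\frac{4\pi}{3m},\,\tilde x_j-\frac{\pi}{3m}]$. (e) $\tilde q(t)\ge 0.529$ for all $t\in\mathbb T$ with $t\notin\bigcup_{k=1}^s[\tilde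 x_k-\frac{4\pi}{3m},\,\tilde x_k+\frac{4\pi}{3m}]$. (f) $\tilde q'(t)\le 0.292\,m^2|t-\tilde x_j|$ for all $t\in[\tilde x_j+\frac{\pi}{3m},\,\tilde x_j+\frac{4\pi}{3m}]$, and $\tilde q'(t)\ge -0.292\,m^2|t-\tilde x_j|$ for all $t\in[\tilde x_j-\frac{4\pi}{3m},\,\tilde x_j-\frac{\pi}{3m}]$. -/

import Mathlib

/-! Points of the torus `𝕋 = ℝ / 2πℤ` are given by real representatives, and functions on `𝕋` by
`2π`-periodic functions on `ℝ`, so that derivatives are ordinary derivatives. -/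

namespace MUSIC

/-- The distance `min_{n ∈ ℤ} |u - v + 2πn|` on the torus `ℝ / 2πℤ`
(the quotient norm of Mathlib's `AddCircle`). -/
noncomputable def torusDist (u v : ℝ) : ℝ :=
  ‖((u - v : ℝ) : AddCircle (2 * Real.pi))‖

/-- The minimum separation `Δ(x) = min_{j ≠ k} |x_j - x_k|` in the torus distance; it is `∞` if there
are fewer than two points and `0` if two of the points coincide on the torus. -/
noncomputable def minSep {s : ℕ} (x : Fin s → ℝ) : ENNReal :=
  ⨅ (j : Fin s) (k : Fin s) (_ : j ≠ k), ENNReal.ofReal (torusDist (x j) (x k))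

/-- The elements `-(m-1)/2, -(m-3)/2, …, (m-1)/2` of the index set `I(m)`. -/
noncomputable def freq (m : ℕ) (i : Fin m) : ℝ :=
  (i : ℝ) - ((m : ℝ) - 1) / 2

/-- The `m × s` Fourier matrix `Φ(m, x) = [e^{i k x_j}]_{k ∈ I(m), j}`. -/
noncomputable def fourierMatrix (m : ℕ) {s : ℕ} (x : Fin s → ℝ) : Matrix (Fin m) (Fin s) ℂ :=
  Matrix.of fun i j => Complex.exp (Complex.I * (freq m i : ℂ) * (x j : ℂ))

/-- The Fourier subspace generated by `x`: the range of `Φ(m, x)`, in `ℂ^m` with its Euclidean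
structure. -/
noncomputable def fourierSubspace (m : ℕ) {s : ℕ} (x : Fin s → ℝ) :
    Submodule ℂ (EuclideanSpace ℂ (Fin m)) :=
  LinearMap.range (Matrix.toEuclideanLin (fourierMatrix m x))

/-- The sine-theta distance: the operator norm of the difference of the orthogonal projections
(`V V* - W W*` for matrices `V`, `W` whose columns are orthonormal bases of the subspaces). -/
noncomputable def sinTheta {m : ℕ} (V W : Submodule ℂ (EuclideanSpace ℂ (Fin m))) : ℝ :=
  ‖V.starProjection - W.starProjection‖

/-- The subspace error `ϑ(x, W)` between the Fourier subspace generated by `x` and `W`. -/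
noncomputable def subspaceError {m s : ℕ} (x : Fin s → ℝ)
    (W : Submodule ℂ (EuclideanSpace ℂ (Fin m))) : ℝ :=
  sinTheta (fourierSubspace m x) W

/-- The normalized steering vector `φ(t) = m^{-1/2} [e^{ikt}]_{k ∈ I(m)}`. -/
noncomputable def steering (m : ℕ) (t : ℝ) : EuclideanSpace ℂ (Fin m) :=
  WithLp.toLp 2 fun i =>
    ((1 / Real.sqrt (m : ℝ) : ℝ) : ℂ) * Complex.exp (Complex.I * (freq m i : ℂ) * (t : ℂ))

/-- The landscape function `q_W(t) = 1 - ‖W* φ(t)‖²` of a subspace `W` of `ℂ^m`; for a matrix `W`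
with orthonormal columns, `‖W* v‖` is the norm of the orthogonal projection of `v` onto the range. -/
noncomputable def landscape {m : ℕ} (W : Submodule ℂ (EuclideanSpace ℂ (Fin m))) (t : ℝ) : ℝ :=
  1 - ‖W.starProjection (steering m t)‖ ^ 2

end MUSIC

/-!
The orthogonal projection onto the Fourier subspace of well separated nodes is, near each node,
almost the projection onto the steering vector of that node alone. For a single node the landscape
function is `1 - D ^ 2` with the Dirichlet kernel `D t = sin (m t / 2) / (m sin (t / 2))`, whose
slope and curvature are estimated by Taylor bounds (`one_node_slope_near` and its companions,
`one_node_curvature`).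

The other nodes enter through two facts. First, the steering vectors of separated nodes have a lower
frame bound `0.69` (`Separated.le_norm_sum_smul_steering_sq`). The Dirichlet kernel decays too
slowly for its Gram matrix to be diagonally dominant, but replacing the sum over all frequencies by
the average over about `m / 6` shifts of a window of length about `5 m / 6` only lowers the
quadratic form and turns the kernel into a product of two Dirichlet kernels, which decays
quadratically (`le_sum_norm_sq_expSum`). Consequently the squared norm of a projection is at
most the sum of squares of the coefficients against the steering vectors, divided by `0.69`
(`Separated.norm_starProjection_sq_le`). Second, with `φ` the steering vector and `e` the one at the
node, the `residual` `φ⁽ᵖ⁾(t) - ⟨e, φ⁽ᵖ⁾(t)⟩ e` is orthogonal to `e`, so its projection only sees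
the other nodes, whose contributions are square summable (`Separated.sum_inv_sq_le`,
`Separated.norm_starProjection_residual_le`). The landscape function is the one-node landscape minus
the squared norm of the projected residual for `p = 0`, and its first two derivatives split in the
same way (`landscapeD_fourierSubspace`, `landscapeDD_fourierSubspace`).

Replacing the Fourier subspace by a subspace at sine-theta distance `ϑ` changes the landscape and
its first two derivatives by at most `ϑ`, `0.5774 m ϑ` and `0.41 m ^ 2 ϑ`. Since the slope at a
node is therefore at most `0.5774 m ϑ` and the curvature around it at least `0.1 m ^ 2`, there is a
critical point within `7 ϑ / m` of the node; the remaining bounds are transferred from the node to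
the critical point.
-/

namespace MUSIC

open Real

/-! ### Elementary trigonometric bounds -/

theorem cos_le_taylor_four {x : ℝ} (hx : 0 ≤ x) : cos x ≤ 1 - x ^ 2 / 2 + x ^ 4 / 24 := by
  have h : MonotoneOn (fun y : ℝ => 1 - y ^ 2 / 2 + y ^ 4 / 24 - cos y) (Set.Ici 0) := by
    refine monotoneOn_of_hasDerivWithinAt_nonneg (f' := fun y => -y + y ^ 3 / 6 + sin y)
      (convex_Ici 0) (by fun_prop) (fun y _ => HasDerivAt.hasDerivWithinAt ?_) fun y hy => ?_
    · exact HasDerivAt.congr_deriv (((((hasDerivAt_id y).pow 2).div_const 2).const_sub 1).add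
        (((hasDerivAt_id y).pow 4).div_const 24) |>.sub (hasDerivAt_cos y) :) (by simp; ring)
    · rw [interior_Ici] at hy
      linarith [sin_ge_sub_cube (le_of_lt hy)]
  have := h (Set.mem_Ici.2 le_rfl) (Set.mem_Ici.2 hx) hx
  simp at this
  linarith

theorem sin_le_taylor_five {x : ℝ} (hx : 0 ≤ x) : sin x ≤ x - x ^ 3 / 6 + x ^ 5 / 120 := by
  have h : MonotoneOn (fun y : ℝ => y - y ^ 3 / 6 + y ^ 5 / 120 - sin y) (Set.Ici 0) := by
    refine monotoneOn_of_hasDerivWithinAt_nonneg (f' := fun y => 1 - y ^ 2 / 2 + y ^ 4 / 24 - cos y)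
      (convex_Ici 0) (by fun_prop) (fun y _ => HasDerivAt.hasDerivWithinAt ?_) fun y hy => ?_
    · exact HasDerivAt.congr_deriv
        (((hasDerivAt_id y).sub (((hasDerivAt_id y).pow 3).div_const 6)).add
        (((hasDerivAt_id y).pow 5).div_const 120) |>.sub (hasDerivAt_sin y) :) (by simp; ring)
    · rw [interior_Ici] at hy
      linarith [cos_le_taylor_four (le_of_lt hy)]
  have := h (Set.mem_Ici.2 le_rfl) (Set.mem_Ici.2 hx) hx
  simp at this
  linarith

theorem taylor_six_le_cos {x : ℝ} (hx : 0 ≤ x) :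
    1 - x ^ 2 / 2 + x ^ 4 / 24 - x ^ 6 / 720 ≤ cos x := by
  have h : MonotoneOn (fun y : ℝ => cos y - (1 - y ^ 2 / 2 + y ^ 4 / 24 - y ^ 6 / 720))
      (Set.Ici 0) := by
    refine monotoneOn_of_hasDerivWithinAt_nonneg
      (f' := fun y => -sin y + (y - y ^ 3 / 6 + y ^ 5 / 120))
      (convex_Ici 0) (by fun_prop) (fun y _ => HasDerivAt.hasDerivWithinAt ?_) fun y hy => ?_
    · exact HasDerivAt.congr_deriv ((hasDerivAt_cos y).sub
        ((((((hasDerivAt_id y).pow 2).div_const 2).const_sub 1).add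
          (((hasDerivAt_id y).pow 4).div_const 24)).sub
          (((hasDerivAt_id y).pow 6).div_const 720)) :) (by simp; ring)
    · rw [interior_Ici] at hy
      linarith [sin_le_taylor_five (le_of_lt hy)]
  have := h (Set.mem_Ici.2 le_rfl) (Set.mem_Ici.2 hx) hx
  simp at this
  linarith

theorem taylor_seven_le_sin {x : ℝ} (hx : 0 ≤ x) :
    x - x ^ 3 / 6 + x ^ 5 / 120 - x ^ 7 / 5040 ≤ sin x := by
  have h : MonotoneOn (fun y : ℝ => sin y - (y - y ^ 3 / 6 + y ^ 5 / 120 - y ^ 7 / 5040))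
      (Set.Ici 0) := by
    refine monotoneOn_of_hasDerivWithinAt_nonneg
      (f' := fun y => cos y - (1 - y ^ 2 / 2 + y ^ 4 / 24 - y ^ 6 / 720))
      (convex_Ici 0) (by fun_prop) (fun y _ => HasDerivAt.hasDerivWithinAt ?_) fun y hy => ?_
    · exact HasDerivAt.congr_deriv ((hasDerivAt_sin y).sub
        ((((hasDerivAt_id y).sub (((hasDerivAt_id y).pow 3).div_const 6)).add
          (((hasDerivAt_id y).pow 5).div_const 120)).sub
          (((hasDerivAt_id y).pow 7).div_const 5040)) :) (by simp; ring)
    · rw [interior_Ici] at hy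
      linarith [taylor_six_le_cos (le_of_lt hy)]
  have := h (Set.mem_Ici.2 le_rfl) (Set.mem_Ici.2 hx) hx
  simp at this
  linarith

/-- The derivative of `sin x - x * cos x` is `x * sin x`, so a Taylor bound for `sin` integrates
to this one. -/
theorem taylor_le_sin_sub_mul_cos {x : ℝ} (hx : 0 ≤ x) :
    x ^ 3 / 3 - x ^ 5 / 30 + x ^ 7 / 840 - x ^ 9 / 45360 ≤ sin x - x * cos x := by
  have h : MonotoneOn (fun y : ℝ => sin y - y * cos y -
      (y ^ 3 / 3 - y ^ 5 / 30 + y ^ 7 / 840 - y ^ 9 / 45360)) (Set.Ici 0) := by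
    refine monotoneOn_of_hasDerivWithinAt_nonneg
      (f' := fun y => y * (sin y - (y - y ^ 3 / 6 + y ^ 5 / 120 - y ^ 7 / 5040)))
      (convex_Ici 0) (by fun_prop) (fun y _ => HasDerivAt.hasDerivWithinAt ?_) fun y hy => ?_
    · exact HasDerivAt.congr_deriv
        (((hasDerivAt_sin y).sub ((hasDerivAt_id y).mul (hasDerivAt_cos y))).sub
        ((((((hasDerivAt_id y).pow 3).div_const 3).sub (((hasDerivAt_id y).pow 5).div_const 30)).add
          (((hasDerivAt_id y).pow 7).div_const 840)).sub
          (((hasDerivAt_id y).pow 9).div_const 45360)) :) (by simp; ring)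
    · rw [interior_Ici] at hy
      have := taylor_seven_le_sin (le_of_lt hy)
      exact mul_nonneg (le_of_lt hy) (by linarith)
  have := h (Set.mem_Ici.2 le_rfl) (Set.mem_Ici.2 hx) hx
  simp at this
  linarith

/-- Equivalent to `tan v ≥ v`. -/
theorem one_div_sin_sq_le {v : ℝ} (hv : 0 < v) (hv' : v ≤ π / 2) :
    1 / sin v ^ 2 ≤ 1 / v ^ 2 + 1 := by
  have hs : 0 < sin v := sin_pos_of_pos_of_lt_pi hv (by linarith [pi_pos])
  have key : v * cos v ≤ sin v := by
    rcases hv'.lt_or_eq with h | h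
    · have hc : 0 < cos v := cos_pos_of_mem_Ioo ⟨by linarith [pi_pos], h⟩
      have := le_tan hv.le h
      rwa [tan_eq_sin_div_cos, le_div_iff₀ hc] at this
    · rw [h, cos_pi_div_two, mul_zero, ← h]; exact hs.le
  have hc : 0 ≤ cos v := cos_nonneg_of_mem_Icc ⟨by linarith [pi_pos], hv'⟩
  have h2 : v ^ 2 * cos v ^ 2 ≤ sin v ^ 2 := by
    rw [← mul_pow]; exact pow_le_pow_left₀ (by positivity) key 2
  rw [div_add_one (by positivity), div_le_div_iff₀ (by positivity) (by positivity)]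
  nlinarith [sin_sq_add_cos_sq v]

/-! ### The Dirichlet kernel -/

/-- The normalized Dirichlet kernel `(1/m) ∑_{k ∈ I(m)} e^{ikt}`, written with cosines since `I(m)`
is symmetric about `0`. -/
noncomputable def dirichlet (m : ℕ) (t : ℝ) : ℝ :=
  (∑ i : Fin m, cos (freq m i * t)) / m

/-- The first derivative of `dirichlet m`. -/
noncomputable def dirichletD (m : ℕ) (t : ℝ) : ℝ :=
  (∑ i : Fin m, -(freq m i * sin (freq m i * t))) / m

/-- The second derivative of `dirichlet m`. -/
noncomputable def dirichletDD (m : ℕ) (t : ℝ) : ℝ :=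
  (∑ i : Fin m, -(freq m i ^ 2 * cos (freq m i * t))) / m

theorem hasDerivAt_dirichlet (m : ℕ) (t : ℝ) :
    HasDerivAt (dirichlet m) (dirichletD m t) t := by
  unfold dirichlet dirichletD
  refine (HasDerivAt.fun_sum fun i _ => ?_).div_const _
  exact HasDerivAt.congr_deriv (((hasDerivAt_id t).const_mul (freq m i)).cos :) (by simp; ring)

theorem hasDerivAt_dirichletD (m : ℕ) (t : ℝ) :
    HasDerivAt (dirichletD m) (dirichletDD m t) t := by
  unfold dirichletD dirichletDD
  refine (HasDerivAt.fun_sum fun i _ => ?_).div_const _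
  exact HasDerivAt.congr_deriv
    ((((hasDerivAt_id t).const_mul (freq m i)).sin.const_mul (freq m i)).neg :) (by simp; ring)

theorem freq_rev (m : ℕ) (i : Fin m) : freq m i.rev = -freq m i := by
  have := i.2
  simp only [freq, Fin.val_rev]
  rw [Nat.cast_sub (by omega)]
  push_cast; ring

theorem sum_sin_freq (m : ℕ) (t : ℝ) : ∑ i : Fin m, sin (freq m i * t) = 0 := by
  have h := Equiv.sum_comp (Fin.revPerm (n := m)) fun i => sin (freq m i * t)
  simp only [Fin.revPerm_apply, freq_rev, neg_mul, sin_neg, Finset.sum_neg_distrib] at h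
  linarith

theorem sum_freq_sq (m : ℕ) : ∑ i : Fin m, freq m i ^ 2 = m * ((m : ℝ) ^ 2 - 1) / 12 := by
  have h : ∀ (c : ℝ) (n : ℕ), ∑ i ∈ Finset.range n, ((i : ℝ) - c) ^ 2
      = n * (n - 1) * (2 * n - 1) / 6 - c * (n * (n - 1)) + n * c ^ 2 := by
    intro c n
    induction n with
    | zero => simp
    | succ n ih => rw [Finset.sum_range_succ, ih]; push_cast; ring
  simp only [freq]
  rw [Fin.sum_univ_eq_sum_range (fun i : ℕ => ((i : ℝ) - ((m : ℝ) - 1) / 2) ^ 2) m, h]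
  ring

theorem sum_freq_sq_le (m : ℕ) : ∑ i : Fin m, freq m i ^ 2 ≤ (m : ℝ) ^ 3 / 12 := by
  rw [sum_freq_sq]
  have : (0 : ℝ) ≤ m := by positivity
  nlinarith

theorem dirichlet_zero {m : ℕ} (hm : 0 < m) : dirichlet m 0 = 1 := by
  have : (m : ℝ) ≠ 0 := by positivity
  simp [dirichlet, this]

theorem dirichlet_mul_sin {m : ℕ} (hm : 0 < m) (t : ℝ) :
    m * (dirichlet m t * sin (t / 2)) = sin (m * t / 2) := by
  have hm' : (m : ℝ) ≠ 0 := by positivity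
  have h : ∀ i : ℕ, 2 * sin (t / 2) * cos (((i : ℝ) - ((m : ℝ) - 1) / 2) * t)
      = sin ((((i + 1 : ℕ) : ℝ) - m / 2) * t) - sin (((i : ℝ) - m / 2) * t) := by
    intro i
    have h1 : (((i + 1 : ℕ) : ℝ) - m / 2) * t = ((i : ℝ) - ((m : ℝ) - 1) / 2) * t + t / 2 := by
      push_cast; ring
    have h2 : ((i : ℝ) - m / 2) * t = ((i : ℝ) - ((m : ℝ) - 1) / 2) * t - t / 2 := by ring
    rw [h1, h2, sin_add, sin_sub]; ring
  have hsum : 2 * sin (t / 2) * ∑ i : Fin m, cos (freq m i * t) = 2 * sin (m * t / 2) := by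
    simp only [freq]
    rw [Fin.sum_univ_eq_sum_range (fun i : ℕ => cos (((i : ℝ) - ((m : ℝ) - 1) / 2) * t)) m,
      Finset.mul_sum, Finset.sum_congr rfl fun i _ => h i,
      Finset.sum_range_sub (fun i : ℕ => sin (((i : ℝ) - m / 2) * t))]
    have h1 : ((m : ℝ) - m / 2) * t = m * t / 2 := by ring
    have h2 : (((0 : ℕ) : ℝ) - m / 2) * t = -(m * t / 2) := by push_cast; ring
    rw [h1, h2, sin_neg]; ring
  have : m * dirichlet m t = ∑ i : Fin m, cos (freq m i * t) := by
    rw [dirichlet, mul_div_cancel₀ _ hm']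
  rw [← mul_assoc, this]; linarith

theorem dirichletD_mul_sin {m : ℕ} (hm : 0 < m) (t : ℝ) :
    2 * (dirichletD m t * sin (t / 2)) = cos (m * t / 2) - dirichlet m t * cos (t / 2) := by
  have hm' : (m : ℝ) ≠ 0 := by positivity
  have h1 : HasDerivAt (fun u => m * (dirichlet m u * sin (u / 2)))
      (m * (dirichletD m t * sin (t / 2) + dirichlet m t * (cos (t / 2) * (1 / 2)))) t :=
    ((hasDerivAt_dirichlet m t).mul ((hasDerivAt_id t).div_const 2).sin).const_mul _
  have h2 : HasDerivAt (fun u : ℝ => sin (m * u / 2)) (cos (m * t / 2) * (m * 1 / 2)) t :=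
    (((hasDerivAt_id t).const_mul (m : ℝ)).div_const 2).sin
  have h3 := h1.unique (h2.congr_of_eventuallyEq (.of_forall fun u => dirichlet_mul_sin hm u))
  field_simp at h3
  linarith

theorem dirichletDD_mul_sin {m : ℕ} (hm : 0 < m) (t : ℝ) :
    dirichletDD m t * sin (t / 2) =
      -(m / 4 * sin (m * t / 2)) - dirichletD m t * cos (t / 2) +
        dirichlet m t * sin (t / 2) / 4 := by
  have h1 : HasDerivAt (fun u => 2 * (dirichletD m u * sin (u / 2)))
      (2 * (dirichletDD m t * sin (t / 2) + dirichletD m t * (cos (t / 2) * (1 / 2)))) t :=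
    ((hasDerivAt_dirichletD m t).mul ((hasDerivAt_id t).div_const 2).sin).const_mul _
  have h2 : HasDerivAt (fun u : ℝ => cos (m * u / 2) - dirichlet m u * cos (u / 2))
      (-sin (m * t / 2) * (m * 1 / 2) -
        (dirichletD m t * cos (t / 2) + dirichlet m t * (-sin (t / 2) * (1 / 2)))) t :=
    (((hasDerivAt_id t).const_mul (m : ℝ)).div_const 2).cos.sub
      ((hasDerivAt_dirichlet m t).mul ((hasDerivAt_id t).div_const 2).cos)
  have h3 := h1.unique (h2.congr_of_eventuallyEq (.of_forall fun u => dirichletD_mul_sin hm u))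
  linarith

/-- Decay of the kernel in terms of a bound `σ` for `1 / (m |sin (t / 2)|)`; the hypothesis also
excludes `sin (t / 2) = 0`. -/
theorem abs_dirichlet_le_of_sin {m : ℕ} (hm : 0 < m) {t σ : ℝ} (hσ : 1 ≤ σ * (m * |sin (t / 2)|)) :
    |dirichlet m t| ≤ σ := by
  have hm' : (0 : ℝ) < m := by positivity
  have h := congrArg abs (dirichlet_mul_sin hm t)
  rw [abs_mul, abs_mul, abs_of_pos hm'] at h
  have hs := abs_sin_le_one (m * t / 2)
  have hpos : 0 < m * |sin (t / 2)| := by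
    rcases (abs_nonneg (sin (t / 2))).eq_or_lt with h0 | h0
    · rw [← h0] at hσ; norm_num at hσ
    · positivity
  refine le_of_mul_le_mul_right ?_ hpos
  nlinarith

theorem abs_dirichletD_le_of_sin {m : ℕ} (hm : 0 < m) {t σ : ℝ}
    (hσ : 1 ≤ σ * (m * |sin (t / 2)|)) :
    |dirichletD m t| ≤ m * (σ * (1 + σ) / 2) := by
  have hm' : (0 : ℝ) < m := by positivity
  have h := congrArg abs (dirichletD_mul_sin hm t)
  rw [abs_mul, abs_mul, abs_of_pos (zero_lt_two)] at h
  have hpos : 0 < |sin (t / 2)| := by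
    rcases (abs_nonneg (sin (t / 2))).eq_or_lt with h0 | h0
    · rw [← h0] at hσ; norm_num at hσ
    · exact h0
  have h0 := abs_dirichlet_le_of_sin hm hσ
  have h1 : |cos (m * t / 2) - dirichlet m t * cos (t / 2)| ≤ 1 + σ := by
    refine (abs_sub _ _).trans (add_le_add (abs_cos_le_one _) ?_)
    rw [abs_mul]
    nlinarith [abs_cos_le_one (t / 2), abs_nonneg (cos (t / 2)), abs_nonneg (dirichlet m t)]
  refine le_of_mul_le_mul_right ?_ hpos
  have : (0 : ℝ) ≤ 1 + σ := by linarith [abs_nonneg (dirichlet m t)]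
  nlinarith

theorem abs_dirichletDD_le_of_sin {m : ℕ} (hm : 0 < m) {t σ : ℝ}
    (hσ : 1 ≤ σ * (m * |sin (t / 2)|)) :
    |dirichletDD m t| ≤ m ^ 2 * (σ / 4 + σ ^ 2 * (1 + σ) / 2) + σ / 4 := by
  have hm' : (0 : ℝ) < m := by positivity
  have h := congrArg abs (dirichletDD_mul_sin hm t)
  rw [abs_mul] at h
  have hpos : 0 < |sin (t / 2)| := by
    rcases (abs_nonneg (sin (t / 2))).eq_or_lt with h0 | h0
    · rw [← h0] at hσ; norm_num at hσ
    · exact h0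
  have h0 := abs_dirichlet_le_of_sin hm hσ
  have h1 := abs_dirichletD_le_of_sin hm hσ
  have hσ0 : 0 ≤ σ := (abs_nonneg _).trans h0
  have e1 : |m / 4 * sin (m * t / 2)| ≤ m / 4 := by
    rw [abs_mul, abs_of_pos (by positivity : (0 : ℝ) < m / 4)]
    nlinarith [abs_sin_le_one (m * t / 2)]
  have e2 : |dirichletD m t * cos (t / 2)| ≤ m * (σ * (1 + σ) / 2) := by
    rw [abs_mul]
    nlinarith [abs_cos_le_one (t / 2), abs_nonneg (cos (t / 2)), abs_nonneg (dirichletD m t)]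
  have e3 : |dirichlet m t * sin (t / 2) / 4| ≤ σ * |sin (t / 2)| / 4 := by
    rw [abs_div, abs_mul, abs_of_pos (by norm_num : (0 : ℝ) < 4)]
    gcongr
  have h2 : |dirichletDD m t| * |sin (t / 2)| ≤
      m / 4 + m * (σ * (1 + σ) / 2) + σ * |sin (t / 2)| / 4 := by
    rw [h]
    refine (abs_add_le _ _).trans (add_le_add ((abs_sub _ _).trans (add_le_add ?_ e2)) e3)
    rwa [abs_neg]
  refine le_of_mul_le_mul_right (h2.trans ?_) hpos
  have e4 : m / 4 + m * (σ * (1 + σ) / 2) ≤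
      (m / 4 + m * (σ * (1 + σ) / 2)) * (σ * (m * |sin (t / 2)|)) :=
    le_mul_of_one_le_right (by positivity) hσ
  nlinarith

theorem abs_dirichlet_le_one (m : ℕ) (t : ℝ) : |dirichlet m t| ≤ 1 := by
  rw [dirichlet, abs_div, Nat.abs_cast]
  refine div_le_one_of_le₀ ((Finset.abs_sum_le_sum_abs _ _).trans ?_) (by positivity)
  refine (Finset.sum_le_sum fun i _ => abs_cos_le_one _).trans ?_
  simp

theorem abs_dirichletD_le {m : ℕ} (hm : 0 < m) (t : ℝ) : |dirichletD m t| ≤ m ^ 2 / 12 * |t| := by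
  have hm' : (0 : ℝ) < m := by positivity
  rw [dirichletD, abs_div, Nat.abs_cast, div_le_iff₀ hm']
  refine (Finset.abs_sum_le_sum_abs _ _).trans ?_
  have : ∀ i : Fin m, |-(freq m i * sin (freq m i * t))| ≤ freq m i ^ 2 * |t| := by
    intro i
    rw [abs_neg, abs_mul, ← sq_abs, sq, mul_assoc, ← abs_mul (freq m i) t]
    exact mul_le_mul_of_nonneg_left abs_sin_le_abs (abs_nonneg _)
  refine (Finset.sum_le_sum fun i _ => this i).trans ?_
  rw [← Finset.sum_mul]
  nlinarith [sum_freq_sq_le m, abs_nonneg t]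

theorem abs_dirichletDD_le {m : ℕ} (hm : 0 < m) (t : ℝ) : |dirichletDD m t| ≤ m ^ 2 / 12 := by
  have hm' : (0 : ℝ) < m := by positivity
  rw [dirichletDD, abs_div, Nat.abs_cast, div_le_iff₀ hm']
  refine (Finset.abs_sum_le_sum_abs _ _).trans ?_
  have : ∀ i : Fin m, |-(freq m i ^ 2 * cos (freq m i * t))| ≤ freq m i ^ 2 := by
    intro i
    rw [abs_neg, abs_mul, abs_of_nonneg (sq_nonneg _)]
    exact mul_le_of_le_one_right (sq_nonneg _) (abs_cos_le_one _)
  refine (Finset.sum_le_sum fun i _ => this i).trans ?_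
  nlinarith [sum_freq_sq_le m]

theorem one_sub_le_dirichlet {m : ℕ} (hm : 0 < m) (t : ℝ) :
    1 - (m * t) ^ 2 / 24 ≤ dirichlet m t := by
  have hm' : (0 : ℝ) < m := by positivity
  rw [dirichlet, le_div_iff₀ hm']
  have : ∀ i : Fin m, 1 - freq m i ^ 2 * (t ^ 2 / 2) ≤ cos (freq m i * t) := by
    intro i
    have := one_sub_sq_div_two_le_cos (x := freq m i * t)
    linarith [mul_pow (freq m i) t 2]
  refine le_trans ?_ (Finset.sum_le_sum fun i _ => this i)
  rw [Finset.sum_sub_distrib, ← Finset.sum_mul]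
  simp
  nlinarith [sum_freq_sq_le m, sq_nonneg t]

theorem sum_freq_pow_four_le (m : ℕ) : ∑ i : Fin m, freq m i ^ 4 ≤ (m : ℝ) ^ 5 / 80 := by
  have h : ∀ (c : ℝ) (n : ℕ), ∑ i ∈ Finset.range n, ((i : ℝ) - c) ^ 4
      = n * (n - 1) * (2 * n - 1) * (3 * n ^ 2 - 3 * n - 1) / 30 - c * (n * (n - 1)) ^ 2
        + c ^ 2 * (n * (n - 1) * (2 * n - 1)) - 2 * c ^ 3 * (n * (n - 1)) + n * c ^ 4 := by
    intro c n
    induction n with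
    | zero => simp
    | succ n ih => rw [Finset.sum_range_succ, ih]; push_cast; ring
  simp only [freq]
  rw [Fin.sum_univ_eq_sum_range (fun i : ℕ => ((i : ℝ) - ((m : ℝ) - 1) / 2) ^ 4) m, h]
  rcases Nat.eq_zero_or_pos m with rfl | hm
  · simp
  have hm' : (1 : ℝ) ≤ m := by exact_mod_cast hm
  have : (m : ℝ) ^ 5 / 80 - m * ((m : ℝ) ^ 2 - 1) * (3 * m ^ 2 - 7) / 240
      = m * (10 * m ^ 2 - 7) / 240 := by ring
  have h2 : 0 ≤ m * (10 * (m : ℝ) ^ 2 - 7) / 240 := by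
    have : 0 ≤ 10 * (m : ℝ) ^ 2 - 7 := by nlinarith
    positivity
  nlinarith

theorem le_neg_dirichletDD {m : ℕ} (hm : 0 < m) (t : ℝ) :
    ((m : ℝ) ^ 2 - 1) / 12 - m ^ 2 * (m * t) ^ 2 / 160 ≤ -dirichletDD m t := by
  have hm' : (0 : ℝ) < m := by positivity
  rw [dirichletDD, ← neg_div, le_div_iff₀ hm', ← Finset.sum_neg_distrib]
  have : ∀ i : Fin m, freq m i ^ 2 - freq m i ^ 4 * (t ^ 2 / 2) ≤
      -(-(freq m i ^ 2 * cos (freq m i * t))) := by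
    intro i
    have := one_sub_sq_div_two_le_cos (x := freq m i * t)
    have h2 := mul_le_mul_of_nonneg_left this (sq_nonneg (freq m i))
    rw [neg_neg]
    refine le_trans (le_of_eq ?_) h2
    ring
  refine le_trans ?_ (Finset.sum_le_sum fun i _ => this i)
  rw [Finset.sum_sub_distrib, ← Finset.sum_mul, sum_freq_sq]
  have := mul_le_mul_of_nonneg_right (sum_freq_pow_four_le m) (by positivity : 0 ≤ t ^ 2 / 2)
  linarith [this, show (m : ℝ) ^ 5 / 80 * (t ^ 2 / 2) = m ^ 2 * (m * t) ^ 2 / 160 * m by ring]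

/-- With `a = m * t / 2` and `S = m * sin (t / 2) ≤ a`, the derivative of `-D ^ 2` for the kernel
`D = sin a / S` is `m * sin a / S ^ 2 * (sin a * cos (t / 2) / S - cos a)`; replacing `S` by `a`
and `cos (t / 2)` by `1 - t ^ 2 / 8` gives the bound. -/
theorem le_neg_two_mul_dirichlet_mul_dirichletD {m : ℕ} (hm : 100 ≤ m) {t a : ℝ}
    (hat : m * t = 2 * a) (ha : 0 < a) (ha' : a ≤ 2.2) {u : ℝ} (hu : 1 / 20000 ≤ u)
    (hua : u ≤ 1 / 3 - a ^ 2 / 30 + a ^ 4 / 840 - a ^ 6 / 45360) :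
    m * (sin a * (u - 1 / 20000)) ≤ -(2 * (dirichlet m t * dirichletD m t)) := by
  have hm0 : 0 < m := by omega
  have hm' : (100 : ℝ) ≤ m := by exact_mod_cast hm
  have ht : t = 2 * a / m := by field_simp; linarith
  have htpos : 0 < t := by rw [ht]; positivity
  have htle : t ≤ 1 := by rw [ht, div_le_one (by positivity)]; linarith
  have hsa : 0 < sin a := sin_pos_of_pos_of_lt_pi ha (by linarith [pi_gt_three])
  have hs : 0 < sin (t / 2) := sin_pos_of_pos_of_lt_pi (by positivity) (by linarith [pi_gt_three])
  have hS : m * sin (t / 2) ≤ a := by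
    have := mul_le_mul_of_nonneg_left (sin_le (by positivity : 0 ≤ t / 2))
      (by positivity : (0 : ℝ) ≤ m)
    linarith
  have hc : 1 - t ^ 2 / 8 ≤ cos (t / 2) := by
    have := one_sub_sq_div_two_le_cos (x := t / 2)
    linarith [this, show (t / 2) ^ 2 / 2 = t ^ 2 / 8 by ring]
  have hc0 : 0 ≤ 1 - t ^ 2 / 8 := by nlinarith
  set S := m * sin (t / 2) with hSdef
  have hSpos : 0 < S := by positivity
  have h0 : dirichlet m t = sin a / S := by
    rw [eq_div_iff hSpos.ne']
    have := dirichlet_mul_sin hm0 t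
    rw [hat, mul_div_cancel_left₀ _ (two_ne_zero)] at this
    rw [← this, hSdef]; ring
  have h1 : 2 * dirichletD m t = m * (cos a - sin a / S * cos (t / 2)) / S := by
    rw [eq_div_iff hSpos.ne']
    have := dirichletD_mul_sin hm0 t
    rw [hat, mul_div_cancel_left₀ _ (two_ne_zero), h0] at this
    rw [← this, hSdef]; ring
  have e : -(2 * (dirichlet m t * dirichletD m t))
      = m * (sin a / S ^ 2 * (sin a * cos (t / 2) / S - cos a)) := by
    rw [show -(2 * (dirichlet m t * dirichletD m t)) = -(dirichlet m t * (2 * dirichletD m t)) by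
      ring, h0, h1]
    field_simp
    ring
  rw [e]
  refine mul_le_mul_of_nonneg_left ?_ (by positivity)
  have hta : t ^ 2 / 8 ≤ a ^ 2 / 20000 := by
    rw [ht, div_pow, mul_pow, div_div, div_le_div_iff₀ (by positivity) (by positivity)]
    have : (10000 : ℝ) ≤ m ^ 2 := by nlinarith
    nlinarith [sq_nonneg a]
  have h2 : a ^ 2 * (u - 1 / 20000) ≤ sin a * cos (t / 2) / S - cos a := by
    have hcos : 0 ≤ cos (t / 2) := hc0.trans hc
    have k1 : sin a * (1 - t ^ 2 / 8) / a ≤ sin a * cos (t / 2) / S := by gcongr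
    have k2 := taylor_le_sin_sub_mul_cos ha.le
    have k3 : sin a * (t ^ 2 / 8) ≤ a * (a ^ 2 / 20000) :=
      mul_le_mul (sin_le ha.le) hta (by positivity) ha.le
    have k4 : a ^ 2 * (u - 1 / 20000) + cos a ≤ sin a * (1 - t ^ 2 / 8) / a := by
      rw [le_div_iff₀ ha]
      have k5 := mul_le_mul_of_nonneg_left hua (by positivity : 0 ≤ a ^ 3)
      nlinarith
    linarith
  have h3 : 0 ≤ a ^ 2 * (u - 1 / 20000) := mul_nonneg (by positivity) (by linarith)
  calc sin a * (u - 1 / 20000) = sin a / a ^ 2 * (a ^ 2 * (u - 1 / 20000)) := by field_simp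
    _ ≤ sin a / S ^ 2 * (sin a * cos (t / 2) / S - cos a) := by gcongr

theorem le_sin_of_mem_Icc {a : ℝ} (h1 : 1 ≤ a) (h2 : a ≤ 2.14) : 0.83 ≤ sin a := by
  have h3 : 0.83 ≤ sin 1 := by
    have := sin_ge_sub_cube (x := 1) zero_le_one
    norm_num at this ⊢; linarith
  rcases le_total a (π / 2) with h | h
  · exact h3.trans (sin_le_sin_of_le_of_le_pi_div_two (by linarith [pi_pos]) h h1)
  · rw [← sin_pi_sub]
    have : (3.14 : ℝ) < π := pi_gt_d2
    exact h3.trans (sin_le_sin_of_le_of_le_pi_div_two (by linarith [pi_pos])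
      (by linarith) (by norm_num at *; linarith))

/-- Lower bounds for the slope of the one-node landscape `1 - D ^ 2`. -/
theorem one_node_slope_near {m : ℕ} (hm : 100 ≤ m) {t : ℝ} (h1 : 0.97 ≤ m * t) (h2 : m * t ≤ 2) :
    m * 0.139 ≤ -(2 * (dirichlet m t * dirichletD m t)) := by
  obtain ⟨a, ha⟩ : ∃ a, m * t = 2 * a := ⟨m * t / 2, by ring⟩
  rw [ha] at h1 h2
  have a1 : 0.485 ≤ a := by norm_num at *; linarith
  have a2 : a ≤ 1 := by linarith
  have hw0 : 0.2 ≤ a ^ 2 := by norm_num at *; nlinarith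
  have hw : a ^ 2 ≤ 1 := by nlinarith
  refine le_trans ?_ (le_neg_two_mul_dirichlet_mul_dirichletD hm ha (by norm_num at *; linarith)
    (by norm_num; linarith) (u := 0.2999) (by norm_num) ?_)
  · refine mul_le_mul_of_nonneg_left ?_ (by positivity)
    have := sin_ge_sub_cube (x := a) (by norm_num at *; linarith)
    have : 0.4659 ≤ sin a := by
      refine le_trans ?_ this
      have : 0 ≤ (a - 0.485) * (1 - (a ^ 2 + 0.485 * a + 0.485 ^ 2) / 6) :=
        mul_nonneg (by linarith) (by norm_num; linarith)
      norm_num at *; nlinarith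
    norm_num at *; linarith
  · have e4 : a ^ 4 = (a ^ 2) ^ 2 := by ring
    have e6 : a ^ 6 = (a ^ 2) ^ 3 := by ring
    rw [e4, e6]
    generalize a ^ 2 = w at *
    norm_num at *
    nlinarith [mul_nonneg (sq_nonneg w) (sub_nonneg.2 hw)]

theorem one_node_slope_middle {m : ℕ} (hm : 100 ≤ m) {t : ℝ} (h1 : 2 ≤ m * t)
    (h2 : m * t ≤ 3.6) :
    m * 0.195 ≤ -(2 * (dirichlet m t * dirichletD m t)) := by
  obtain ⟨a, ha⟩ : ∃ a, m * t = 2 * a := ⟨m * t / 2, by ring⟩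
  rw [ha] at h1 h2
  have a1 : 1 ≤ a := by linarith
  have a2 : a ≤ 1.8 := by norm_num at *; linarith
  have hw0 : 0 ≤ a ^ 2 := by positivity
  have hw : a ^ 2 ≤ 3.24 := by norm_num at *; nlinarith
  refine le_trans ?_ (le_neg_two_mul_dirichlet_mul_dirichletD hm ha (by linarith)
    (by norm_num at *; linarith) (u := 0.2355) (by norm_num) ?_)
  · refine mul_le_mul_of_nonneg_left ?_ (by positivity)
    have := le_sin_of_mem_Icc a1 (by norm_num at *; linarith)
    norm_num at *; linarith
  · have e4 : a ^ 4 = (a ^ 2) ^ 2 := by ring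
    have e6 : a ^ 6 = (a ^ 2) ^ 3 := by ring
    rw [e4, e6]
    generalize a ^ 2 = w at *
    norm_num at *
    nlinarith [mul_nonneg (sq_nonneg w) (sub_nonneg.2 hw)]

theorem one_node_slope_far {m : ℕ} (hm : 100 ≤ m) {t : ℝ} (h1 : 2 ≤ m * t)
    (h2 : m * t ≤ 4.27) :
    m * 0.168 ≤ -(2 * (dirichlet m t * dirichletD m t)) := by
  obtain ⟨a, ha⟩ : ∃ a, m * t = 2 * a := ⟨m * t / 2, by ring⟩
  rw [ha] at h1 h2
  have a1 : 1 ≤ a := by linarith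
  have a2 : a ≤ 2.135 := by norm_num at *; linarith
  have hw0 : 0 ≤ a ^ 2 := by positivity
  have hw : a ^ 2 ≤ 4.5583 := by norm_num at *; nlinarith
  refine le_trans ?_ (le_neg_two_mul_dirichlet_mul_dirichletD hm ha (by linarith)
    (by norm_num at *; linarith) (u := 0.203) (by norm_num) ?_)
  · refine mul_le_mul_of_nonneg_left ?_ (by positivity)
    have := le_sin_of_mem_Icc a1 (by norm_num at *; linarith)
    norm_num at *; linarith
  · have e4 : a ^ 4 = (a ^ 2) ^ 2 := by ring
    have e6 : a ^ 6 = (a ^ 2) ^ 3 := by ring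
    rw [e4, e6]
    generalize a ^ 2 = w at *
    norm_num at *
    nlinarith [mul_nonneg (sq_nonneg w) (sub_nonneg.2 hw)]

/-- Near its node the one-node landscape `1 - D ^ 2` is uniformly convex. -/
theorem one_node_curvature {m : ℕ} (hm : 100 ≤ m) {t T : ℝ} (hT : m * |t| ≤ T) (hT' : T ≤ 1.2) :
    m ^ 2 * (2 * (1 - T ^ 2 / 24) * (0.9999 / 12 - T ^ 2 / 160) - T ^ 2 / 72) ≤
      -(2 * (dirichlet m t * dirichletDD m t + dirichletD m t ^ 2)) := by
  have hm0 : 0 < m := by omega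
  have hm' : (100 : ℝ) ≤ m := by exact_mod_cast hm
  have hm2 : (10000 : ℝ) ≤ m ^ 2 := by nlinarith
  have hT0 : 0 ≤ T := le_trans (by positivity) hT
  have hsq : (m * t) ^ 2 ≤ T ^ 2 := by
    rw [← sq_abs, abs_mul, Nat.abs_cast]; exact pow_le_pow_left₀ (by positivity) hT 2
  have hT2 : T ^ 2 ≤ 1.44 := by norm_num at *; nlinarith
  have h0 := one_sub_le_dirichlet hm0 t
  have h2 := le_neg_dirichletDD hm0 t
  have h1 := abs_dirichletD_le hm0 t
  have h1' : dirichletD m t ^ 2 ≤ (m ^ 2) * (T ^ 2 / 144) := by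
    rw [← sq_abs]
    have : |dirichletD m t| ≤ m / 12 * T := by nlinarith
    calc _ ≤ (m / 12 * T) ^ 2 := pow_le_pow_left₀ (abs_nonneg _) this 2
      _ = _ := by ring
  have h0' : 1 - T ^ 2 / 24 ≤ dirichlet m t := by linarith
  have h2' : m ^ 2 * (0.9999 / 12 - T ^ 2 / 160) ≤ -dirichletDD m t := by
    have := mul_le_mul_of_nonneg_left hsq (by positivity : (0 : ℝ) ≤ m ^ 2)
    norm_num at *; nlinarith
  have h3 := mul_le_mul h0' h2' (mul_nonneg (by positivity) (by norm_num at *; linarith))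
    (le_trans (by norm_num at *; linarith) h0')
  nlinarith

theorem one_node_slope_le {m : ℕ} (hm : 0 < m) (t : ℝ) :
    |2 * (dirichlet m t * dirichletD m t)| ≤ m ^ 2 / 6 * |t| := by
  rw [abs_mul, abs_mul, abs_of_pos zero_lt_two]
  nlinarith [abs_dirichlet_le_one m t, abs_dirichletD_le hm t, abs_nonneg (dirichlet m t),
    abs_nonneg (dirichletD m t)]

theorem one_node_curvature_le {m : ℕ} (hm : 0 < m) (t : ℝ) :
    -(2 * (dirichlet m t * dirichletDD m t + dirichletD m t ^ 2)) ≤ m ^ 2 / 6 := by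
  have h := neg_abs_le (dirichlet m t * dirichletDD m t)
  rw [abs_mul] at h
  nlinarith [abs_dirichlet_le_one m t, abs_dirichletDD_le hm t, abs_nonneg (dirichlet m t),
    abs_nonneg (dirichletDD m t), sq_nonneg (dirichletD m t)]

/-! ### Separated points on the torus -/

theorem torusDist_comm (u v : ℝ) : torusDist u v = torusDist v u := by
  rw [torusDist, torusDist, ← norm_neg, ← AddCircle.coe_neg, neg_sub]

theorem torusDist_triangle (u v w : ℝ) : torusDist u w ≤ torusDist u v + torusDist v w := by
  simp only [torusDist]
  rw [show u - w = (u - v) + (v - w) by ring, AddCircle.coe_add]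
  exact norm_add_le _ _

theorem torusDist_nonneg (u v : ℝ) : 0 ≤ torusDist u v := norm_nonneg _

theorem exists_abs_eq_torusDist (u v : ℝ) :
    ∃ n : ℤ, |u - v - n * (2 * π)| = torusDist u v :=
  ⟨_, (AddCircle.norm_eq (2 * π)).symm⟩

theorem torusDist_le_abs (u v : ℝ) : torusDist u v ≤ |u - v| := by
  have := round_le ((2 * π)⁻¹ * (u - v)) 0
  rw [torusDist, AddCircle.norm_eq' _ two_pi_pos]
  have h := mul_le_mul_of_nonneg_left this two_pi_pos.le
  simp only [Int.cast_zero, sub_zero, abs_mul, abs_inv, abs_of_pos two_pi_pos] at h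
  rwa [mul_inv_cancel_left₀ two_pi_pos.ne'] at h

theorem torusDist_le_abs_sub_int (u v : ℝ) (n : ℤ) : torusDist u v ≤ |u - v - n * (2 * π)| := by
  have h := torusDist_le_abs (u - n * (2 * π)) v
  rw [torusDist] at h ⊢
  have e : ((u - n * (2 * π) - v : ℝ) : AddCircle (2 * π)) = ((u - v : ℝ) : AddCircle (2 * π)) := by
    rw [show u - n * (2 * π) - v = (u - v) - n • (2 * π) by simp; ring, AddCircle.coe_sub,
      AddCircle.coe_zsmul, AddCircle.coe_period, smul_zero, sub_zero]
  rw [e] at h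
  rwa [show u - v - n * (2 * π) = u - n * (2 * π) - v by ring]

theorem torusDist_le_pi (u v : ℝ) : torusDist u v ≤ π := by
  have := AddCircle.norm_le_half_period (2 * π) (x := ((u - v : ℝ) : AddCircle (2 * π)))
    two_pi_pos.ne'
  rw [abs_of_pos two_pi_pos] at this
  rw [torusDist]; linarith

theorem abs_sin_half_eq_sin_torusDist (u v : ℝ) :
    |sin ((u - v) / 2)| = sin (torusDist u v / 2) := by
  obtain ⟨n, hn⟩ := exists_abs_eq_torusDist u v
  have h1 : (u - v) / 2 = (u - v - n * (2 * π)) / 2 + n * π := by ring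
  have hpi := torusDist_le_pi u v
  rw [h1, sin_add_int_mul_pi, abs_mul, ← hn]
  have : |(-1 : ℝ) ^ n| = 1 := by simp [abs_zpow]
  rw [this, one_mul]
  rw [← hn] at hpi
  have h0 : 0 ≤ sin (|u - v - n * (2 * π)| / 2) :=
    sin_nonneg_of_nonneg_of_le_pi (by positivity) (by linarith [pi_pos])
  rcases abs_cases (u - v - n * (2 * π)) with ⟨h, -⟩ | ⟨h, -⟩
  · rw [h] at h0 ⊢; exact abs_of_nonneg h0
  · rw [h, neg_div, sin_neg] at h0 ⊢; exact abs_of_nonpos (by linarith)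

/-- A decay bound `σ ≥ 1 / (m |sin ((u - v) / 2)|)` obtained from a lower bound `d` for the torus
distance of `u` and `v`. -/
theorem one_le_mul_abs_sin {m : ℕ} (hm : 0 < m) {u v d : ℝ} (hd : 0 < d) (h : d ≤ torusDist u v) :
    1 ≤ √((4 / d ^ 2 + 1) / m ^ 2) * (m * |sin ((u - v) / 2)|) := by
  have hm' : (0 : ℝ) < m := by positivity
  have hD : 0 < torusDist u v := hd.trans_le h
  have hpi := torusDist_le_pi u v
  rw [abs_sin_half_eq_sin_torusDist]
  have hs : 0 < sin (torusDist u v / 2) :=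
    sin_pos_of_pos_of_lt_pi (by positivity) (by linarith [pi_pos])
  have key := one_div_sin_sq_le (v := torusDist u v / 2) (by positivity) (by linarith [pi_pos])
  have h2 : 1 / (torusDist u v / 2) ^ 2 ≤ 4 / d ^ 2 := by
    rw [div_pow, one_div_div]
    norm_num
    gcongr
  have h3 : (1 / (m * sin (torusDist u v / 2))) ^ 2 ≤ (4 / d ^ 2 + 1) / m ^ 2 := by
    rw [div_pow, mul_pow, one_pow, mul_comm, ← div_div]
    gcongr
    linarith
  have h4 := Real.le_sqrt_of_sq_le h3
  have h5 := mul_le_mul_of_nonneg_right h4 (by positivity : 0 ≤ m * sin (torusDist u v / 2))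
  rwa [one_div, inv_mul_cancel₀ (by positivity)] at h5

/-- The points of a `δ`-separated set in `[δ, π]` are at most as dense as the multiples of `δ`,
because `u ↦ ⌊u / δ⌋` is injective on it. -/
theorem sum_inv_sq_le_of_separated {ι : Type*} (S : Finset ι) (u : ι → ℝ) {δ a b : ℝ}
    (hδ : 0 < δ) (ha : 0 ≤ a) (hb : 0 ≤ b) (h1 : ∀ k ∈ S, δ ≤ u k) (h2 : ∀ k ∈ S, u k ≤ π)
    (h3 : ∀ k ∈ S, ∀ l ∈ S, k ≠ l → δ ≤ |u k - u l|) :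
    ∑ k ∈ S, (a / u k ^ 2 + b) ≤ a * (π ^ 2 / (6 * δ ^ 2)) + b * (π / δ) := by
  have hinj : Set.InjOn (fun k => ⌊u k / δ⌋₊) S := by
    intro k hk l hl hkl
    by_contra hne
    have hk0 : 0 ≤ u k / δ := div_nonneg (hδ.le.trans (h1 k hk)) hδ.le
    have hl0 : 0 ≤ u l / δ := div_nonneg (hδ.le.trans (h1 l hl)) hδ.le
    have k1 := Nat.floor_le hk0
    have k2 := Nat.lt_floor_add_one (u k / δ)
    have l1 := Nat.floor_le hl0
    have l2 := Nat.lt_floor_add_one (u l / δ)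
    simp only at hkl
    rw [hkl] at k1 k2
    have h := h3 k hk l hl hne
    have : |u k / δ - u l / δ| < 1 := by rw [abs_lt]; constructor <;> linarith
    rw [← sub_div, abs_div, abs_of_pos hδ, div_lt_one hδ] at this
    linarith
  set I := S.image fun k => ⌊u k / δ⌋₊ with hI
  have hmem : ∀ n ∈ I, 1 ≤ n ∧ n ≤ ⌊π / δ⌋₊ := by
    intro n hn
    obtain ⟨k, hk, rfl⟩ := Finset.mem_image.1 hn
    constructor
    · rw [Nat.le_floor_iff' one_ne_zero, Nat.cast_one, le_div_iff₀ hδ]; linarith [h1 k hk]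
    · exact Nat.floor_mono (by gcongr; exact h2 k hk)
  have hcard : (I.card : ℝ) ≤ π / δ := by
    have : I.card ≤ ⌊π / δ⌋₊ := by
      have := Finset.card_le_card (fun n hn => Finset.mem_Icc.2 (hmem n hn) : I ⊆ Finset.Icc 1 _)
      simpa using this
    exact (Nat.cast_le.2 this).trans (Nat.floor_le (by positivity))
  have hzeta : ∑ n ∈ I, 1 / (n : ℝ) ^ 2 ≤ π ^ 2 / 6 :=
    sum_le_hasSum I (fun n _ => by positivity) hasSum_zeta_two
  calc ∑ k ∈ S, (a / u k ^ 2 + b)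
      ≤ ∑ k ∈ S, (a / δ ^ 2 * (1 / ((⌊u k / δ⌋₊ : ℕ) : ℝ) ^ 2) + b) := by
        refine Finset.sum_le_sum fun k hk => ?_
        have hk0 : 0 ≤ u k / δ := div_nonneg (hδ.le.trans (h1 k hk)) hδ.le
        have k1 := Nat.floor_le hk0
        have hn := (hmem _ (Finset.mem_image_of_mem _ hk)).1
        have hn' : (0 : ℝ) < (⌊u k / δ⌋₊ : ℕ) := by exact_mod_cast hn
        rw [le_div_iff₀ hδ] at k1
        rw [div_mul_div_comm, mul_one, ← mul_pow, mul_comm δ]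
        gcongr
    _ = ∑ n ∈ I, (a / δ ^ 2 * (1 / (n : ℝ) ^ 2) + b) := by rw [hI, Finset.sum_image hinj]
    _ = a / δ ^ 2 * ∑ n ∈ I, 1 / (n : ℝ) ^ 2 + b * I.card := by
        rw [Finset.sum_add_distrib, ← Finset.mul_sum, Finset.sum_const, nsmul_eq_mul, mul_comm b]
    _ ≤ a / δ ^ 2 * (π ^ 2 / 6) + b * (π / δ) := by gcongr
    _ = _ := by field_simp

/-- The points of the torus are separated by at least `8 π / m`. -/
def Separated (m : ℕ) {s : ℕ} (x : Fin s → ℝ) : Prop :=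
  ∀ j k, j ≠ k → 8 * π / m ≤ torusDist (x j) (x k)

theorem Separated.of_le_minSep {m s : ℕ} {x : Fin s → ℝ}
    (h : ENNReal.ofReal (8 * π / m) ≤ minSep x) : Separated m x := by
  intro j k hjk
  simp only [minSep, le_iInf_iff] at h
  exact (ENNReal.ofReal_le_ofReal_iff (torusDist_nonneg _ _)).1 (h j k hjk)

theorem Separated.sum_inv_sq_le {m s : ℕ} (hm : 0 < m) {x : Fin s → ℝ} (hx : Separated m x)
    (j : Fin s) {a b : ℝ} (ha : 0 ≤ a) (hb : 0 ≤ b) :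
    ∑ k ∈ Finset.univ.erase j, (a / torusDist (x k) (x j) ^ 2 + b) ≤
      a * (m ^ 2 / 192) + b * (m / 4) := by
  have hm' : (0 : ℝ) < m := by positivity
  have hδ : 0 < 8 * π / m := by positivity
  choose n hn using fun k => exists_abs_eq_torusDist (x k) (x j)
  set u : Fin s → ℝ := fun k => x k - x j - n k * (2 * π) with hu
  have hsep : ∀ k l, k ≠ l → 8 * π / m ≤ |u k - u l| := by
    intro k l hkl
    refine (hx k l hkl).trans ((torusDist_le_abs_sub_int _ _ (n k - n l)).trans (le_of_eq ?_))
    congr 1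
    simp only [hu]; push_cast; ring
  have hfar : ∀ k, k ≠ j → 8 * π / m ≤ |u k| := fun k hk => (hx k j hk).trans (hn k).ge
  have hpi : ∀ k, |u k| ≤ π := fun k => (hn k).le.trans (torusDist_le_pi _ _)
  have hpos := sum_inv_sq_le_of_separated ((Finset.univ.erase j).filter fun k => 0 ≤ u k) u hδ ha hb
    (fun k hk => by
      obtain ⟨hk1, hk2⟩ := Finset.mem_filter.1 hk
      have := hfar k (Finset.ne_of_mem_erase hk1)
      rwa [abs_of_nonneg hk2] at this)
    (fun k _ => (le_abs_self _).trans (hpi k)) (fun k _ l _ hkl => hsep k l hkl)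
  have hneg := sum_inv_sq_le_of_separated ((Finset.univ.erase j).filter fun k => ¬ 0 ≤ u k)
    (fun k => -u k) hδ ha hb
    (fun k hk => by
      obtain ⟨hk1, hk2⟩ := Finset.mem_filter.1 hk
      have := hfar k (Finset.ne_of_mem_erase hk1)
      rwa [abs_of_neg (not_le.1 hk2)] at this)
    (fun k _ => (neg_le_abs _).trans (hpi k))
    (fun k _ l _ hkl => by
      have := hsep k l hkl
      rwa [show -u k - -u l = -(u k - u l) by ring, abs_neg])
  have e : ∀ k, torusDist (x k) (x j) ^ 2 = u k ^ 2 := fun k => by rw [← hn k, sq_abs]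
  simp only [e]
  simp only [neg_sq] at hneg
  rw [← Finset.sum_filter_add_sum_filter_not (Finset.univ.erase j) fun k => 0 ≤ u k]
  refine (add_le_add hpos hneg).trans (le_of_eq ?_)
  field_simp
  ring

/-! ### Steering vectors -/

/-- The `p`-th derivative of the steering vector, `m^{-1/2} [(ik)^p e^{ikt}]_{k ∈ I(m)}`. -/
noncomputable def steeringDeriv (m p : ℕ) (t : ℝ) : EuclideanSpace ℂ (Fin m) :=
  WithLp.toLp 2 fun i => ((1 / √(m : ℝ) : ℝ) : ℂ) *
    ((Complex.I * (freq m i : ℂ)) ^ p * Complex.exp (Complex.I * (freq m i : ℂ) * (t : ℂ)))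

theorem steeringDeriv_zero (m : ℕ) : steeringDeriv m 0 = steering m := by
  ext t i
  simp [steeringDeriv, steering]

theorem hasDerivAt_steeringDeriv (m p : ℕ) (t : ℝ) :
    HasDerivAt (steeringDeriv m p) (steeringDeriv m (p + 1) t) t := by
  have h : HasDerivAt (fun u : ℝ => fun i : Fin m => ((1 / √(m : ℝ) : ℝ) : ℂ) *
      ((Complex.I * (freq m i : ℂ)) ^ p * Complex.exp (Complex.I * (freq m i : ℂ) * (u : ℂ))))
      (fun i : Fin m => ((1 / √(m : ℝ) : ℝ) : ℂ) *
        ((Complex.I * (freq m i : ℂ)) ^ (p + 1) *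
          Complex.exp (Complex.I * (freq m i : ℂ) * (t : ℂ)))) t := by
    rw [hasDerivAt_pi]
    intro i
    have h1 : HasDerivAt (fun u : ℝ => Complex.I * (freq m i : ℂ) * (u : ℂ))
        (Complex.I * (freq m i : ℂ) * 1) t := (Complex.ofRealCLM.hasDerivAt (x := t)).const_mul _
    exact ((h1.cexp.const_mul ((Complex.I * (freq m i : ℂ)) ^ p)).const_mul
      ((1 / √(m : ℝ) : ℝ) : ℂ)).congr_deriv (by ring)
  exact (PiLp.hasFDerivAt_toLp (𝕜 := ℝ) 2 _).comp_hasDerivAt t h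

theorem norm_steeringDeriv_sq (m p : ℕ) (t : ℝ) :
    ‖steeringDeriv m p t‖ ^ 2 = (∑ i : Fin m, freq m i ^ (2 * p)) / m := by
  rw [EuclideanSpace.norm_sq_eq, Finset.sum_div]
  refine Finset.sum_congr rfl fun i _ => ?_
  have h : ‖Complex.exp (Complex.I * (freq m i : ℂ) * (t : ℂ))‖ = 1 := by
    rw [mul_assoc, ← Complex.ofReal_mul, mul_comm, Complex.norm_exp_ofReal_mul_I]
  simp only [steeringDeriv, norm_mul, norm_pow, h, Complex.norm_I, Complex.norm_real,
    Real.norm_eq_abs, mul_one, mul_pow, sq_abs]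
  rw [div_pow, Real.sq_sqrt (by positivity), ← pow_mul |freq m i|, mul_comm p 2,
    pow_mul |freq m i|, sq_abs, ← pow_mul]
  ring

theorem norm_steering {m : ℕ} (hm : 0 < m) (t : ℝ) : ‖steering m t‖ = 1 := by
  have h := norm_steeringDeriv_sq m 0 t
  have : (m : ℝ) ≠ 0 := by positivity
  simp only [mul_zero, pow_zero, Finset.sum_const, Finset.card_univ, Fintype.card_fin,
    nsmul_eq_mul, mul_one, div_self this, steeringDeriv_zero] at h
  rwa [pow_eq_one_iff_of_nonneg (norm_nonneg _) two_ne_zero] at h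

theorem norm_steeringDeriv_one_sq_le {m : ℕ} (hm : 0 < m) (t : ℝ) :
    ‖steeringDeriv m 1 t‖ ^ 2 ≤ m ^ 2 / 12 := by
  have : (0 : ℝ) < m := by positivity
  rw [norm_steeringDeriv_sq, div_le_iff₀ this]
  linarith [sum_freq_sq_le m, show (m : ℝ) ^ 2 / 12 * m = m ^ 3 / 12 by ring]

theorem norm_steeringDeriv_one_le {m : ℕ} (hm : 0 < m) (t : ℝ) :
    ‖steeringDeriv m 1 t‖ ≤ 0.2887 * m := by
  have h := norm_steeringDeriv_one_sq_le hm t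
  refine le_of_sq_le_sq (h.trans ?_) (by positivity)
  nlinarith [sq_nonneg (m : ℝ)]

theorem norm_steeringDeriv_two_le {m : ℕ} (hm : 0 < m) (t : ℝ) :
    ‖steeringDeriv m 2 t‖ ≤ 0.12 * m ^ 2 := by
  have hm' : (0 : ℝ) < m := by positivity
  have h : ‖steeringDeriv m 2 t‖ ^ 2 ≤ m ^ 4 / 80 := by
    rw [norm_steeringDeriv_sq, div_le_iff₀ hm']
    linarith [sum_freq_pow_four_le m, show (m : ℝ) ^ 4 / 80 * m = m ^ 5 / 80 by ring]
  refine le_of_sq_le_sq (h.trans ?_) (by positivity)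
  have : 0 ≤ (m : ℝ) ^ 4 := by positivity
  nlinarith

theorem inner_steering_steering (m : ℕ) (a t : ℝ) :
    inner ℂ (steering m a) (steering m t) = (dirichlet m (t - a) : ℂ) := by
  have hterm : ∀ i : Fin m, inner ℂ (steering m a i) (steering m t i) =
      (((cos (freq m i * (t - a)) / m : ℝ) : ℂ)) +
        ((sin (freq m i * (t - a)) / m : ℝ) : ℂ) * Complex.I := by
    intro i
    have hc : (starRingEnd ℂ) (Complex.exp (Complex.I * (freq m i : ℂ) * (a : ℂ))) =
        Complex.exp (-(Complex.I * (freq m i : ℂ) * (a : ℂ))) := by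
      rw [← Complex.exp_conj]; simp
    have he : Complex.exp (Complex.I * (freq m i : ℂ) * (t : ℂ)) *
        Complex.exp (-(Complex.I * (freq m i : ℂ) * (a : ℂ))) =
        Complex.exp ((freq m i * (t - a) : ℝ) * Complex.I) := by
      rw [← Complex.exp_add]; congr 1; push_cast; ring
    have hs : ((1 / √(m : ℝ) : ℝ) : ℂ) * ((1 / √(m : ℝ) : ℝ) : ℂ) = ((1 / m : ℝ) : ℂ) := by
      rw [← Complex.ofReal_mul, div_mul_div_comm, one_mul, Real.mul_self_sqrt (by positivity)]
    rw [RCLike.inner_apply']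
    simp only [steering, map_mul, Complex.conj_ofReal, hc]
    rw [show ∀ p q r : ℂ, p * q * (p * r) = p * p * (r * q) by intros; ring, hs, he,
      Complex.exp_mul_I, ← Complex.ofReal_cos, ← Complex.ofReal_sin]
    push_cast; ring
  rw [PiLp.inner_apply, Finset.sum_congr rfl fun i _ => hterm i, Finset.sum_add_distrib,
    ← Finset.sum_mul, ← Complex.ofReal_sum, ← Complex.ofReal_sum, ← Finset.sum_div,
    ← Finset.sum_div, sum_sin_freq, dirichlet]
  simp

theorem hasDerivAt_inner_steeringDeriv (m p : ℕ) (v : EuclideanSpace ℂ (Fin m)) (t : ℝ) :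
    HasDerivAt (fun u => inner ℂ v (steeringDeriv m p u))
      (inner ℂ v (steeringDeriv m (p + 1) t)) t := by
  simpa using (hasDerivAt_const t v).inner ℂ (hasDerivAt_steeringDeriv m p t)

theorem inner_steering_steeringDeriv_one (m : ℕ) (a t : ℝ) :
    inner ℂ (steering m a) (steeringDeriv m 1 t) = (dirichletD m (t - a) : ℂ) := by
  have h := hasDerivAt_inner_steeringDeriv m 0 (steering m a) t
  simp only [steeringDeriv_zero, inner_steering_steering] at h
  exact h.unique ((hasDerivAt_dirichlet m (t - a)).comp_sub_const t a).ofReal_comp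

theorem inner_steering_steeringDeriv_two (m : ℕ) (a t : ℝ) :
    inner ℂ (steering m a) (steeringDeriv m 2 t) = (dirichletDD m (t - a) : ℂ) := by
  have h := hasDerivAt_inner_steeringDeriv m 1 (steering m a) t
  simp only [inner_steering_steeringDeriv_one] at h
  exact h.unique ((hasDerivAt_dirichletD m (t - a)).comp_sub_const t a).ofReal_comp

theorem abs_dirichletD_le_mul {m : ℕ} (hm : 0 < m) (t : ℝ) : |dirichletD m t| ≤ 0.2887 * m := by
  have h := norm_inner_le_norm (𝕜 := ℂ) (steering m 0) (steeringDeriv m 1 t)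
  rw [inner_steering_steeringDeriv_one, norm_steering hm, one_mul, sub_zero, Complex.norm_real] at h
  exact h.trans (norm_steeringDeriv_one_le hm t)

/-! ### The lower frame bound for separated steering vectors -/

theorem norm_sum_exp_le {θ : ℝ} (hθ : sin (θ / 2) ≠ 0) (n : ℕ) :
    ‖∑ a ∈ Finset.range n, Complex.exp (Complex.I * a * θ)‖ ≤ 1 / |sin (θ / 2)| := by
  have e : ∀ a : ℕ, Complex.exp (Complex.I * a * θ) = Complex.exp (Complex.I * θ) ^ a := by
    intro a; rw [← Complex.exp_nat_mul]; congr 1; ring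
  have h := geom_sum_mul (Complex.exp (Complex.I * θ)) n
  have h' := congrArg norm h
  rw [norm_mul, Complex.norm_exp_I_mul_ofReal_sub_one, norm_mul] at h'
  simp only [e]
  rw [le_div_iff₀ (abs_pos.2 hθ)]
  have h2 : ‖Complex.exp (Complex.I * θ) ^ n - 1‖ ≤ 2 := by
    refine (norm_sub_le _ _).trans ?_
    rw [norm_pow, Complex.norm_exp_I_mul_ofReal]; norm_num
  simp only [Real.norm_eq_abs, abs_two] at h'
  nlinarith

/-- Two-fold averaging of an exponential sum `h` produces a kernel that decays quadratically,
which makes the diagonal dominate. -/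
theorem le_sum_norm_sq_expSum {ι : Type*} [Fintype ι] [DecidableEq ι] (c : ι → ℂ) (x : ι → ℝ)
    (A B : ℕ) {R : ℝ} (hs : ∀ k l, k ≠ l → sin ((x k - x l) / 2) ≠ 0)
    (hR : ∀ l, ∑ k ∈ Finset.univ.erase l, 1 / sin ((x k - x l) / 2) ^ 2 ≤ R) :
    (A * B - R) * ∑ k, ‖c k‖ ^ 2 ≤
      ∑ b ∈ Finset.range B, ∑ a ∈ Finset.range A,
        ‖∑ k, c k * Complex.exp (Complex.I * ((a + b : ℕ) : ℂ) * x k)‖ ^ 2 := by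
  set K : ι → ι → ℂ := fun k l =>
    (∑ b ∈ Finset.range B, Complex.exp (Complex.I * b * (x k - x l : ℝ))) *
      ∑ a ∈ Finset.range A, Complex.exp (Complex.I * a * (x k - x l : ℝ)) with hK
  have hsq : ∀ n : ℕ, ((‖∑ k, c k * Complex.exp (Complex.I * (n : ℂ) * x k)‖ ^ 2 : ℝ) : ℂ) =
      ∑ l, ∑ k, c k * (starRingEnd ℂ) (c l) * Complex.exp (Complex.I * n * (x k - x l : ℝ)) := by
    intro n
    rw [Complex.ofReal_pow, ← Complex.mul_conj', map_sum, Finset.sum_mul_sum, Finset.sum_comm]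
    refine Finset.sum_congr rfl fun l _ => Finset.sum_congr rfl fun k _ => ?_
    rw [map_mul, ← Complex.exp_conj, mul_mul_mul_comm, ← Complex.exp_add]
    congr 2
    simp; ring
  have hexp : ((∑ b ∈ Finset.range B, ∑ a ∈ Finset.range A,
      ‖∑ k, c k * Complex.exp (Complex.I * ((a + b : ℕ) : ℂ) * x k)‖ ^ 2 : ℝ) : ℂ) =
      ∑ l, ∑ k, c k * (starRingEnd ℂ) (c l) * K k l := by
    simp only [Complex.ofReal_sum, hsq]
    rw [Finset.sum_congr rfl fun b _ => Finset.sum_comm, Finset.sum_comm]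
    refine Finset.sum_congr rfl fun l _ => ?_
    rw [Finset.sum_congr rfl fun b _ => Finset.sum_comm, Finset.sum_comm]
    refine Finset.sum_congr rfl fun k _ => ?_
    simp only [hK]
    rw [Finset.sum_mul_sum, Finset.mul_sum]
    refine Finset.sum_congr rfl fun b _ => ?_
    rw [Finset.mul_sum]
    refine Finset.sum_congr rfl fun a _ => ?_
    rw [← Complex.exp_add]
    congr 2
    push_cast; ring
  have hdiag : ∀ l, K l l = (A * B : ℝ) := by
    intro l; simp [hK, mul_comm]
  have hoff : ∀ k l, k ≠ l → ‖K k l‖ ≤ 1 / sin ((x k - x l) / 2) ^ 2 := by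
    intro k l hkl
    rw [hK, norm_mul, ← sq_abs, ← one_div_pow, sq]
    exact mul_le_mul (norm_sum_exp_le (hs k l hkl) B) (norm_sum_exp_le (hs k l hkl) A)
      (norm_nonneg _) (by positivity)
  have hre := congrArg Complex.re hexp
  rw [Complex.ofReal_re] at hre
  rw [hre, Complex.re_sum]
  have hl : ∀ l, A * B * ‖c l‖ ^ 2 - ∑ k ∈ Finset.univ.erase l,
      ((‖c k‖ ^ 2 + ‖c l‖ ^ 2) / 2) * (1 / sin ((x k - x l) / 2) ^ 2) ≤
      (∑ k, c k * (starRingEnd ℂ) (c l) * K k l).re := by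
    intro l
    rw [← Finset.add_sum_erase _ _ (Finset.mem_univ l), hdiag, Complex.mul_conj', Complex.add_re,
      ← Complex.ofReal_pow, ← Complex.ofReal_mul, Complex.ofReal_re, sub_eq_add_neg,
      mul_comm ((A : ℝ) * B), Complex.re_sum, ← Finset.sum_neg_distrib]
    refine add_le_add_right (Finset.sum_le_sum fun k hk => ?_) _
    have h1 := Complex.abs_re_le_norm (c k * (starRingEnd ℂ) (c l) * K k l)
    rw [norm_mul, norm_mul, RCLike.norm_conj] at h1
    have h2 := hoff k l (Finset.ne_of_mem_erase hk)
    have h3 : ‖c k‖ * ‖c l‖ ≤ (‖c k‖ ^ 2 + ‖c l‖ ^ 2) / 2 := by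
      nlinarith [sq_nonneg (‖c k‖ - ‖c l‖)]
    have h4 := mul_le_mul h3 h2 (norm_nonneg _) (by positivity)
    linarith [neg_abs_le (c k * (starRingEnd ℂ) (c l) * K k l).re]
  refine le_trans ?_ (Finset.sum_le_sum fun l _ => hl l)
  rw [Finset.sum_sub_distrib, ← Finset.mul_sum, sub_mul]
  refine sub_le_sub_left ?_ _
  -- by symmetry of the kernel both squares in the mixed sum contribute equally
  have hsplit : ∑ l, ∑ k ∈ Finset.univ.erase l,
      ((‖c k‖ ^ 2 + ‖c l‖ ^ 2) / 2) * (1 / sin ((x k - x l) / 2) ^ 2) =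
      ∑ l, ∑ k ∈ Finset.univ.erase l, ‖c l‖ ^ 2 * (1 / sin ((x k - x l) / 2) ^ 2) := by
    have hswap : ∑ l, ∑ k ∈ Finset.univ.erase l, ‖c k‖ ^ 2 * (1 / sin ((x k - x l) / 2) ^ 2) =
        ∑ l, ∑ k ∈ Finset.univ.erase l, ‖c l‖ ^ 2 * (1 / sin ((x k - x l) / 2) ^ 2) := by
      rw [Finset.sum_comm' (t' := Finset.univ) (s' := fun k => Finset.univ.erase k)
        (by intro a b; simp [eq_comm])]
      refine Finset.sum_congr rfl fun l _ => Finset.sum_congr rfl fun k _ => ?_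
      rw [← neg_sub (x k) (x l), neg_div, sin_neg, neg_sq]
    have : ∀ l, ∑ k ∈ Finset.univ.erase l,
        ((‖c k‖ ^ 2 + ‖c l‖ ^ 2) / 2) * (1 / sin ((x k - x l) / 2) ^ 2) =
        (∑ k ∈ Finset.univ.erase l, ‖c k‖ ^ 2 * (1 / sin ((x k - x l) / 2) ^ 2) +
          ∑ k ∈ Finset.univ.erase l, ‖c l‖ ^ 2 * (1 / sin ((x k - x l) / 2) ^ 2)) / 2 := by
      intro l
      rw [← Finset.sum_add_distrib, Finset.sum_div]
      exact Finset.sum_congr rfl fun k _ => by ring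
    rw [Finset.sum_congr rfl fun l _ => this l, ← Finset.sum_div, Finset.sum_add_distrib, hswap]
    ring
  rw [hsplit, Finset.mul_sum]
  refine Finset.sum_le_sum fun l _ => ?_
  rw [← Finset.mul_sum, mul_comm R]
  exact mul_le_mul_of_nonneg_left (hR l) (sq_nonneg _)

theorem Separated.sum_inv_sin_sq_le {m s : ℕ} (hm : 0 < m) {x : Fin s → ℝ} (hx : Separated m x)
    (l : Fin s) : ∑ k ∈ Finset.univ.erase l, 1 / sin ((x k - x l) / 2) ^ 2 ≤
      (m : ℝ) ^ 2 / 48 + m / 4 := by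
  have h := hx.sum_inv_sq_le hm l (a := 4) (b := 1) (by norm_num) (by norm_num)
  refine le_trans (Finset.sum_le_sum fun k hk => ?_) (h.trans (le_of_eq (by ring)))
  have hm' : (0 : ℝ) < m := by positivity
  have hD : 0 < torusDist (x k) (x l) :=
    lt_of_lt_of_le (by positivity) (hx k l (Finset.ne_of_mem_erase hk))
  have hpi := torusDist_le_pi (x k) (x l)
  rw [← sq_abs, abs_sin_half_eq_sin_torusDist]
  refine (one_div_sin_sq_le (by positivity) (by linarith)).trans (le_of_eq ?_)
  rw [div_pow, one_div_div]; norm_num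

/-- The steering vectors of separated nodes are a Riesz sequence with lower bound `0.69`. -/
theorem Separated.le_norm_sum_smul_steering_sq {m s : ℕ} (hm : 100 ≤ m) {x : Fin s → ℝ}
    (hx : Separated m x) (c : Fin s → ℂ) :
    0.69 * ∑ k, ‖c k‖ ^ 2 ≤ ‖∑ k, c k • steering m (x k)‖ ^ 2 := by
  have hm0 : 0 < m := by omega
  have hm' : (100 : ℝ) ≤ m := by exact_mod_cast hm
  have hmpos : (0 : ℝ) < m := by positivity
  set d : Fin s → ℂ := fun k => c k * Complex.exp ((-(((m : ℝ) - 1) / 2 * x k) : ℝ) * Complex.I)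
    with hd
  have hdc : ∀ k, ‖d k‖ = ‖c k‖ := fun k => by
    rw [hd, norm_mul, Complex.norm_exp_ofReal_mul_I, mul_one]
  set h : ℕ → ℂ := fun n => ∑ k, d k * Complex.exp (Complex.I * (n : ℂ) * x k) with hh
  have hnorm : m * ‖∑ k, c k • steering m (x k)‖ ^ 2 = ∑ n ∈ Finset.range m, ‖h n‖ ^ 2 := by
    rw [EuclideanSpace.norm_sq_eq, Finset.mul_sum,
      ← Fin.sum_univ_eq_sum_range (fun n => ‖h n‖ ^ 2) m]
    refine Finset.sum_congr rfl fun i _ => ?_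
    have : (∑ k, c k • steering m (x k)) i = ((1 / √(m : ℝ) : ℝ) : ℂ) * h i := by
      simp only [WithLp.ofLp_sum, Finset.sum_apply, WithLp.ofLp_smul, Pi.smul_apply, steering,
        smul_eq_mul, hh, hd, Finset.mul_sum]
      refine Finset.sum_congr rfl fun k _ => ?_
      rw [mul_assoc (c k), ← Complex.exp_add, mul_left_comm]
      congr 3
      simp only [freq]; push_cast; ring
    rw [this, norm_mul, mul_pow, Complex.norm_real, Real.norm_eq_abs, sq_abs, div_pow,
      Real.sq_sqrt hmpos.le]
    field_simp
  -- windows of length `A = m + 1 - B`, shifted by `b < B`, stay inside the index range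
  obtain ⟨B, hB1, hB2, hBm⟩ : ∃ B : ℕ, (m : ℝ) / 6 ≤ B ∧ (B : ℝ) ≤ m / 6 + 1 ∧ B ≤ m := by
    refine ⟨⌈(m : ℝ) / 6⌉₊, Nat.le_ceil _, (Nat.ceil_lt_add_one (by positivity)).le, ?_⟩
    rw [Nat.ceil_le]; linarith
  set A := m + 1 - B with hA
  have hA' : (A : ℝ) = m + 1 - B := by
    rw [hA, Nat.cast_sub (by omega)]; push_cast; ring
  have hwin : ∀ b ∈ Finset.range B, ∑ a ∈ Finset.range A, ‖h (a + b)‖ ^ 2 ≤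
      ∑ n ∈ Finset.range m, ‖h n‖ ^ 2 := by
    intro b hb
    have hb' := Finset.mem_range.1 hb
    have e : ∑ a ∈ Finset.range A, ‖h (a + b)‖ ^ 2 = ∑ n ∈ Finset.Ico b (b + A), ‖h n‖ ^ 2 := by
      rw [Finset.sum_Ico_eq_sum_range, Nat.add_sub_cancel_left]
      exact Finset.sum_congr rfl fun a _ => by rw [add_comm]
    rw [e]
    refine Finset.sum_le_sum_of_subset_of_nonneg (fun n hn => ?_) fun _ _ _ => by positivity
    rw [Finset.mem_Ico] at hn
    rw [Finset.mem_range]; omega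
  have h1 := Finset.sum_le_sum hwin
  rw [Finset.sum_const, Finset.card_range, nsmul_eq_mul, ← hnorm] at h1
  have h2 := le_sum_norm_sq_expSum d x A B (R := (m : ℝ) ^ 2 / 48 + m / 4) (fun k l hkl => by
      have hD : 0 < torusDist (x k) (x l) := lt_of_lt_of_le (by positivity) (hx k l hkl)
      have hpi := torusDist_le_pi (x k) (x l)
      have : 0 < |sin ((x k - x l) / 2)| := by
        rw [abs_sin_half_eq_sin_torusDist]
        exact sin_pos_of_pos_of_lt_pi (by positivity) (by linarith [pi_pos])
      exact abs_pos.1 this) fun l => hx.sum_inv_sin_sq_le hm0 l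
  simp only [hdc] at h2
  have h3 := h2.trans h1
  have hBpos : (0 : ℝ) < B := by linarith
  -- `A / m ≥ 5 / 6`, and the off-diagonal part is at most `(m ^ 2 / 48 + m / 4) / (m B) ≤ 0.14`
  have h4 : B * (m * 0.69) ≤ A * B - ((m : ℝ) ^ 2 / 48 + m / 4) := by
    rw [hA']
    norm_num
    nlinarith [mul_nonneg (sub_nonneg.2 hB1) (sub_nonneg.2 hB2)]
  have h5 : 0 ≤ ∑ k, ‖c k‖ ^ 2 := Finset.sum_nonneg fun _ _ => by positivity
  have h6 := (mul_le_mul_of_nonneg_right h4 h5).trans h3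
  rw [mul_assoc, mul_assoc] at h6
  exact le_of_mul_le_mul_left (le_of_mul_le_mul_left h6 hBpos) hmpos

/-- A lower frame bound for a spanning family controls projections by the analysis coefficients. -/
theorem norm_starProjection_sq_le_of_frame {E ι : Type*} [NormedAddCommGroup E]
    [InnerProductSpace ℂ E] [Fintype ι] (V : Submodule ℂ E) [V.HasOrthogonalProjection]
    (v : ι → E) (hV : ∀ w ∈ V, ∃ c : ι → ℂ, w = ∑ k, c k • v k) {lam : ℝ} (hlam : 0 < lam)
    (hv : ∀ c : ι → ℂ, lam * ∑ k, ‖c k‖ ^ 2 ≤ ‖∑ k, c k • v k‖ ^ 2) (z : E) :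
    ‖V.starProjection z‖ ^ 2 ≤ (∑ k, ‖inner ℂ (v k) z‖ ^ 2) / lam := by
  obtain ⟨c, hc⟩ := hV _ (V.starProjection_apply_mem z)
  have h1 : ‖V.starProjection z‖ ^ 2 ≤ ∑ k, ‖c k‖ * ‖inner ℂ (v k) z‖ := by
    refine (V.re_inner_starProjection_eq_normSq z).ge.trans ?_
    refine (RCLike.re_le_norm _).trans ?_
    rw [hc, sum_inner]
    refine (norm_sum_le _ _).trans (le_of_eq (Finset.sum_congr rfl fun k _ => ?_))
    rw [inner_smul_left, norm_mul, RCLike.norm_conj]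
  have h2 := Finset.sum_mul_sq_le_sq_mul_sq Finset.univ (fun k => ‖c k‖) fun k => ‖inner ℂ (v k) z‖
  have h3 := hv c
  rw [← hc] at h3
  set N := ‖V.starProjection z‖ ^ 2 with hN
  set G := ∑ k, ‖inner ℂ (v k) z‖ ^ 2
  have hN0 : 0 ≤ N := by positivity
  have hG0 : 0 ≤ G := Finset.sum_nonneg fun _ _ => by positivity
  rcases hN0.eq_or_lt with h0 | h0
  · rw [← h0]; positivity
  · rw [le_div_iff₀ hlam]
    have h4 : N ^ 2 ≤ (∑ k, ‖c k‖ ^ 2) * G := (pow_le_pow_left₀ hN0 h1 2).trans h2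
    have h5 : N * (N * lam) ≤ N * G := by nlinarith
    exact le_of_mul_le_mul_left h5 h0

theorem toEuclideanLin_fourierMatrix {m s : ℕ} (hm : 0 < m) (x : Fin s → ℝ)
    (c : EuclideanSpace ℂ (Fin s)) :
    Matrix.toEuclideanLin (fourierMatrix m x) c =
      ∑ k, ((√(m : ℝ) : ℂ) * c k) • steering m (x k) := by
  have hm' : (√(m : ℝ) : ℂ) ≠ 0 := by
    rw [Complex.ofReal_ne_zero]; positivity
  ext i
  simp only [Matrix.toLpLin_apply, Matrix.mulVec, dotProduct, fourierMatrix, Matrix.of_apply,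
    WithLp.ofLp_sum, Finset.sum_apply, WithLp.ofLp_smul, Pi.smul_apply, steering, smul_eq_mul]
  refine Finset.sum_congr rfl fun k _ => ?_
  push_cast
  field_simp

theorem exists_eq_sum_steering {m s : ℕ} (hm : 0 < m) (x : Fin s → ℝ)
    {w : EuclideanSpace ℂ (Fin m)} (hw : w ∈ fourierSubspace m x) :
    ∃ c : Fin s → ℂ, w = ∑ k, c k • steering m (x k) := by
  obtain ⟨c, rfl⟩ := hw
  exact ⟨_, toEuclideanLin_fourierMatrix hm x c⟩

theorem steering_mem_fourierSubspace {m s : ℕ} (hm : 0 < m) (x : Fin s → ℝ) (j : Fin s) :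
    steering m (x j) ∈ fourierSubspace m x := by
  have hm' : (√(m : ℝ) : ℂ) ≠ 0 := by
    rw [Complex.ofReal_ne_zero]; positivity
  refine ⟨EuclideanSpace.single j (1 / (√(m : ℝ) : ℂ)), ?_⟩
  rw [toEuclideanLin_fourierMatrix hm, Finset.sum_eq_single j]
  · simp [hm']
  · intro k _ hk; simp [hk]
  · simp

theorem Separated.norm_starProjection_sq_le {m s : ℕ} (hm : 100 ≤ m) {x : Fin s → ℝ}
    (hx : Separated m x) (z : EuclideanSpace ℂ (Fin m)) :
    ‖(fourierSubspace m x).starProjection z‖ ^ 2 ≤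
      (∑ k, ‖inner ℂ (steering m (x k)) z‖ ^ 2) / 0.69 :=
  norm_starProjection_sq_le_of_frame _ _ (fun _ hw => exists_eq_sum_steering (by omega) x hw)
    (by norm_num) (fun c => hx.le_norm_sum_smul_steering_sq hm c) z

/-! ### Contributions of the other nodes -/

/-- A bound for the kernel between a node and any point whose torus distance from the node is at
least `r * D`. -/
noncomputable def decay (m : ℕ) (r D : ℝ) : ℝ := √((4 / (r * D) ^ 2 + 1) / m ^ 2)

theorem decay_nonneg (m : ℕ) (r D : ℝ) : 0 ≤ decay m r D := sqrt_nonneg _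

theorem one_le_decay_mul {m : ℕ} (hm : 0 < m) {r D u v : ℝ} (hr : 0 < r) (hD : 0 < D)
    (h : r * D ≤ torusDist u v) : 1 ≤ decay m r D * (m * |sin ((u - v) / 2)|) :=
  one_le_mul_abs_sin hm (by positivity) h

theorem decay_le {m : ℕ} (hm : 100 ≤ m) {r D σ : ℝ} (hr : 0 < r) (hD : 8 * π / m ≤ D)
    (hσ0 : 0 ≤ σ) (hσ : 4 / (r * 25.132) ^ 2 + 1 / 10000 ≤ σ ^ 2) : decay m r D ≤ σ := by
  have hm' : (100 : ℝ) ≤ m := by exact_mod_cast hm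
  have hmpos : (0 : ℝ) < m := by positivity
  refine Real.sqrt_le_iff.2 ⟨hσ0, le_trans ?_ hσ⟩
  rw [add_div, div_div, ← mul_pow]
  have h1 : r * 25.132 ≤ r * D * m := by
    rw [mul_assoc]
    refine mul_le_mul_of_nonneg_left ?_ hr.le
    rw [div_le_iff₀ hmpos] at hD
    have := pi_gt_d4
    norm_num at *; linarith
  have h2 : (10000 : ℝ) ≤ m ^ 2 := by nlinarith
  gcongr

theorem Separated.sum_decay_sq_le {m s : ℕ} (hm : 100 ≤ m) {x : Fin s → ℝ} (hx : Separated m x)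
    (j : Fin s) {r : ℝ} (hr : 0 < r) :
    ∑ k ∈ Finset.univ.erase j, decay m r (torusDist (x k) (x j)) ^ 2 ≤
      1 / (48 * r ^ 2) + 1 / 400 := by
  have hm' : (100 : ℝ) ≤ m := by exact_mod_cast hm
  have hmpos : (0 : ℝ) < m := by positivity
  have h := hx.sum_inv_sq_le (by omega) j (a := 4 / r ^ 2 / m ^ 2) (b := 1 / m ^ 2)
    (by positivity) (by positivity)
  refine le_trans (le_of_eq (Finset.sum_congr rfl fun k _ => ?_)) (h.trans ?_)
  · rw [decay, Real.sq_sqrt (by positivity), mul_pow, add_div, ← div_div, div_right_comm]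
  · have e : 4 / r ^ 2 / (m : ℝ) ^ 2 * (m ^ 2 / 192) + 1 / (m : ℝ) ^ 2 * (m / 4) =
        1 / (48 * r ^ 2) + 1 / (4 * m) := by
      field_simp; ring
    rw [e]
    have : 1 / (4 * (m : ℝ)) ≤ 1 / 400 := by gcongr; linarith
    linarith

/-- The component of the `p`-th derivative of the steering vector orthogonal to the steering vector
at `a`. -/
noncomputable def residual (m p : ℕ) (a t : ℝ) : EuclideanSpace ℂ (Fin m) :=
  steeringDeriv m p t - inner ℂ (steering m a) (steeringDeriv m p t) • steering m a

theorem inner_steering_self {m : ℕ} (hm : 0 < m) (a : ℝ) :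
    inner ℂ (steering m a) (steering m a) = 1 := by
  rw [inner_steering_steering, sub_self, dirichlet_zero hm, Complex.ofReal_one]

theorem inner_steering_residual_self {m : ℕ} (hm : 0 < m) (p : ℕ) (a t : ℝ) :
    inner ℂ (steering m a) (residual m p a t) = 0 := by
  rw [residual, inner_sub_right, inner_smul_right, inner_steering_self hm, mul_one, sub_self]

theorem hasDerivAt_residual (m p : ℕ) (a t : ℝ) :
    HasDerivAt (residual m p a) (residual m (p + 1) a t) t :=
  (hasDerivAt_steeringDeriv m p t).sub
    ((hasDerivAt_inner_steeringDeriv m p (steering m a) t).smul_const _)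

theorem residual_self {m : ℕ} (hm : 0 < m) (a : ℝ) : residual m 0 a a = 0 := by
  rw [residual, steeringDeriv_zero, inner_steering_self hm, one_smul, sub_self]

/-- Near a node, the projection of the residual only sees the other nodes, whose contributions are
square summable. The constant `25.132` is a lower bound for `8 π`. -/
theorem Separated.norm_starProjection_residual_le {m s : ℕ} (hm : 100 ≤ m) {x : Fin s → ℝ}
    (hx : Separated m x) (j : Fin s) (p : ℕ) {t c d r κ : ℝ} (hr : 0 < r) (hr1 : r ≤ 1)
    (hc : 0 ≤ c) (hκ0 : 0 ≤ κ) (hκ : (1 / (48 * r ^ 2) + 1 / 400) / 0.69 ≤ κ ^ 2)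
    (hk : ∀ k, k ≠ j → ‖inner ℂ (steering m (x k)) (steeringDeriv m p t)‖ ≤
      c * decay m r (torusDist (x k) (x j)))
    (hj : ‖inner ℂ (steering m (x j)) (steeringDeriv m p t)‖ ≤ d) :
    ‖(fourierSubspace m x).starProjection (residual m p (x j) t)‖ ≤ (c + d) * κ := by
  have hd : 0 ≤ d := (norm_nonneg _).trans hj
  have hm0 : 0 < m := by omega
  refine le_of_sq_le_sq ((hx.norm_starProjection_sq_le hm _).trans ?_) (by positivity)
  have hterm : ∀ k ∈ Finset.univ.erase j,
      ‖inner ℂ (steering m (x k)) (residual m p (x j) t)‖ ^ 2 ≤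
        (c + d) ^ 2 * decay m r (torusDist (x k) (x j)) ^ 2 := by
    intro k hk'
    have hkj := Finset.ne_of_mem_erase hk'
    rw [← mul_pow]
    refine pow_le_pow_left₀ (norm_nonneg _) ?_ 2
    have hD : 0 < torusDist (x k) (x j) := lt_of_lt_of_le (by positivity) (hx k j hkj)
    have h1 : |dirichlet m (x j - x k)| ≤ decay m r (torusDist (x k) (x j)) := by
      refine abs_dirichlet_le_of_sin hm0 (one_le_decay_mul hm0 hr hD ?_)
      rw [torusDist_comm (x j)]
      exact mul_le_of_le_one_left hD.le hr1
    rw [residual, inner_sub_right, inner_smul_right, add_mul]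
    refine (norm_sub_le _ _).trans (add_le_add (hk k hkj) ?_)
    rw [norm_mul, inner_steering_steering, Complex.norm_real]
    exact mul_le_mul hj h1 (abs_nonneg _) hd
  rw [← Finset.add_sum_erase _ _ (Finset.mem_univ j), inner_steering_residual_self hm0, norm_zero,
    zero_pow two_ne_zero, zero_add, mul_pow]
  calc _ ≤ (∑ k ∈ Finset.univ.erase j,
        (c + d) ^ 2 * decay m r (torusDist (x k) (x j)) ^ 2) / 0.69 := by
        gcongr with k hk'
        exact hterm k hk'
    _ = (c + d) ^ 2 * ((∑ k ∈ Finset.univ.erase j,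
        decay m r (torusDist (x k) (x j)) ^ 2) / 0.69) := by rw [← Finset.mul_sum, mul_div_assoc]
    _ ≤ (c + d) ^ 2 * ((1 / (48 * r ^ 2) + 1 / 400) / 0.69) := by
        gcongr; exact hx.sum_decay_sq_le hm j hr
    _ ≤ _ := by gcongr

/-! ### Derivatives of landscape functions -/

/-- The real bilinear form `Re ⟨P_W a, b⟩`. -/
noncomputable def projForm {m : ℕ} (W : Submodule ℂ (EuclideanSpace ℂ (Fin m)))
    (a b : EuclideanSpace ℂ (Fin m)) : ℝ :=
  (inner ℂ (W.starProjection a) b).re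

theorem projForm_comm {m : ℕ} (W : Submodule ℂ (EuclideanSpace ℂ (Fin m)))
    (a b : EuclideanSpace ℂ (Fin m)) : projForm W a b = projForm W b a := by
  rw [projForm, projForm, Submodule.inner_starProjection_left_eq_right]
  exact inner_re_symm (𝕜 := ℂ) _ _

theorem projForm_self {m : ℕ} (W : Submodule ℂ (EuclideanSpace ℂ (Fin m)))
    (a : EuclideanSpace ℂ (Fin m)) : projForm W a a = ‖W.starProjection a‖ ^ 2 :=
  W.re_inner_starProjection_eq_normSq a

theorem abs_projForm_le {m : ℕ} (W : Submodule ℂ (EuclideanSpace ℂ (Fin m)))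
    (a b : EuclideanSpace ℂ (Fin m)) :
    |projForm W a b| ≤ ‖W.starProjection a‖ * ‖W.starProjection b‖ := by
  have h : inner ℂ (W.starProjection a) b = inner ℂ (W.starProjection a) (W.starProjection b) := by
    rw [← Submodule.inner_starProjection_left_eq_right,
      Submodule.starProjection_eq_self_iff.2 (W.starProjection_apply_mem a)]
  rw [projForm, h]
  exact (Complex.abs_re_le_norm _).trans (norm_inner_le_norm _ _)

theorem abs_projForm_sub_projForm_le {m : ℕ} (V W : Submodule ℂ (EuclideanSpace ℂ (Fin m)))
    (a b : EuclideanSpace ℂ (Fin m)) :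
    |projForm W a b - projForm V a b| ≤ sinTheta V W * (‖a‖ * ‖b‖) := by
  rw [projForm, projForm, ← Complex.sub_re, ← inner_sub_left, ← sub_apply, sinTheta,
    norm_sub_rev, ← mul_assoc]
  refine (Complex.abs_re_le_norm _).trans ((norm_inner_le_norm _ _).trans ?_)
  gcongr
  exact ContinuousLinearMap.le_opNorm _ _

theorem landscape_eq {m : ℕ} (W : Submodule ℂ (EuclideanSpace ℂ (Fin m))) (t : ℝ) :
    landscape W t = 1 - projForm W (steeringDeriv m 0 t) (steeringDeriv m 0 t) := by
  rw [landscape, projForm_self, steeringDeriv_zero]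

/-- The first derivative of the landscape function. -/
noncomputable def landscapeD {m : ℕ} (W : Submodule ℂ (EuclideanSpace ℂ (Fin m))) (t : ℝ) : ℝ :=
  -(2 * projForm W (steeringDeriv m 0 t) (steeringDeriv m 1 t))

/-- The second derivative of the landscape function. -/
noncomputable def landscapeDD {m : ℕ} (W : Submodule ℂ (EuclideanSpace ℂ (Fin m))) (t : ℝ) : ℝ :=
  -(2 * (projForm W (steeringDeriv m 1 t) (steeringDeriv m 1 t) +
    projForm W (steeringDeriv m 0 t) (steeringDeriv m 2 t)))

theorem hasDerivAt_projForm_steeringDeriv {m : ℕ} (W : Submodule ℂ (EuclideanSpace ℂ (Fin m)))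
    (p q : ℕ) (t : ℝ) :
    HasDerivAt (fun u => projForm W (steeringDeriv m p u) (steeringDeriv m q u))
      (projForm W (steeringDeriv m p t) (steeringDeriv m (q + 1) t) +
        projForm W (steeringDeriv m (p + 1) t) (steeringDeriv m q t)) t := by
  have h := ((W.starProjection.restrictScalars ℝ).hasFDerivAt.comp_hasDerivAt t
    (hasDerivAt_steeringDeriv m p t)).inner ℂ (hasDerivAt_steeringDeriv m q t)
  have h2 := Complex.reCLM.hasFDerivAt.comp_hasDerivAt t h
  exact h2.congr_deriv (by simp [projForm])

theorem hasDerivAt_landscape {m : ℕ} (W : Submodule ℂ (EuclideanSpace ℂ (Fin m))) (t : ℝ) :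
    HasDerivAt (landscape W) (landscapeD W t) t := by
  have h := (hasDerivAt_projForm_steeringDeriv W 0 0 t).const_sub 1
  rw [projForm_comm W (steeringDeriv m (0 + 1) t)] at h
  refine (h.congr_of_eventuallyEq (.of_forall (landscape_eq W))).congr_deriv ?_
  rw [landscapeD]; ring

theorem hasDerivAt_landscapeD {m : ℕ} (W : Submodule ℂ (EuclideanSpace ℂ (Fin m))) (t : ℝ) :
    HasDerivAt (landscapeD W) (landscapeDD W t) t := by
  refine ((hasDerivAt_projForm_steeringDeriv W 0 1 t).const_mul 2).neg.congr_deriv ?_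
  rw [landscapeDD]; ring

theorem deriv_landscape {m : ℕ} (W : Submodule ℂ (EuclideanSpace ℂ (Fin m))) :
    deriv (landscape W) = landscapeD W :=
  funext fun t => (hasDerivAt_landscape W t).deriv

theorem iteratedDeriv_two_landscape {m : ℕ} (W : Submodule ℂ (EuclideanSpace ℂ (Fin m))) (t : ℝ) :
    iteratedDeriv 2 (landscape W) t = landscapeDD W t := by
  rw [iteratedDeriv_succ, iteratedDeriv_one, deriv_landscape]
  exact (hasDerivAt_landscapeD W t).deriv

/-! ### The landscape of a Fourier subspace near a node -/

theorem projForm_add_add {m : ℕ} {V : Submodule ℂ (EuclideanSpace ℂ (Fin m))}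
    {e z w : EuclideanSpace ℂ (Fin m)} (he : e ∈ V) (hee : inner ℂ e e = 1)
    (hz : inner ℂ e z = 0) (hw : inner ℂ e w = 0) (α β : ℝ) :
    projForm V ((α : ℂ) • e + z) ((β : ℂ) • e + w) = α * β + projForm V z w := by
  have h1 : inner ℂ (V.starProjection z) e = 0 := by
    rw [Submodule.inner_starProjection_left_eq_right, Submodule.starProjection_eq_self_iff.2 he,
      ← inner_conj_symm, hz, map_zero]
  simp only [projForm, map_add, map_smul, Submodule.starProjection_eq_self_iff.2 he,
    inner_add_left, inner_add_right, inner_smul_left, inner_smul_right, hee, hw, h1]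
  simp [mul_comm]

theorem projForm_steeringDeriv {m s : ℕ} (hm : 0 < m) (x : Fin s → ℝ) (j : Fin s) {p q : ℕ}
    {t α β : ℝ} (hα : inner ℂ (steering m (x j)) (steeringDeriv m p t) = (α : ℂ))
    (hβ : inner ℂ (steering m (x j)) (steeringDeriv m q t) = (β : ℂ)) :
    projForm (fourierSubspace m x) (steeringDeriv m p t) (steeringDeriv m q t) =
      α * β + projForm (fourierSubspace m x) (residual m p (x j) t) (residual m q (x j) t) := by
  rw [← projForm_add_add (steering_mem_fourierSubspace hm x j) (inner_steering_self hm _)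
    (inner_steering_residual_self hm p _ t) (inner_steering_residual_self hm q _ t) α β,
    residual, residual, hα, hβ, add_sub_cancel, add_sub_cancel]

theorem inner_steering_steeringDeriv_zero (m : ℕ) (a t : ℝ) :
    inner ℂ (steering m a) (steeringDeriv m 0 t) = (dirichlet m (t - a) : ℂ) := by
  rw [steeringDeriv_zero, inner_steering_steering]

theorem landscapeD_fourierSubspace {m s : ℕ} (hm : 0 < m) (x : Fin s → ℝ) (j : Fin s) (t : ℝ) :
    landscapeD (fourierSubspace m x) t =
      -(2 * (dirichlet m (t - x j) * dirichletD m (t - x j))) -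
        2 * projForm (fourierSubspace m x) (residual m 0 (x j) t) (residual m 1 (x j) t) := by
  rw [landscapeD, projForm_steeringDeriv hm x j (inner_steering_steeringDeriv_zero m _ t)
    (inner_steering_steeringDeriv_one m _ t)]
  ring

theorem landscapeDD_fourierSubspace {m s : ℕ} (hm : 0 < m) (x : Fin s → ℝ) (j : Fin s) (t : ℝ) :
    landscapeDD (fourierSubspace m x) t =
      -(2 * (dirichlet m (t - x j) * dirichletDD m (t - x j) + dirichletD m (t - x j) ^ 2)) -
        2 * (projForm (fourierSubspace m x) (residual m 1 (x j) t) (residual m 1 (x j) t) +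
          projForm (fourierSubspace m x) (residual m 0 (x j) t) (residual m 2 (x j) t)) := by
  rw [landscapeDD, projForm_steeringDeriv hm x j (inner_steering_steeringDeriv_zero m _ t)
    (inner_steering_steeringDeriv_two m _ t), projForm_steeringDeriv hm x j
    (inner_steering_steeringDeriv_one m _ t) (inner_steering_steeringDeriv_one m _ t)]
  ring

/-- Admissible constants at the scale `|t - x j| ≤ T / m`: the distances of `t` from the other
nodes are at least `r` times those of `x j`, the kernel at the other nodes is at most `σ`, and `κ`
bounds the projection of a vector whose coefficients at the other nodes are at most the decay
bound. -/
structure IsLocalScale (T r σ κ : ℝ) : Prop where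
  r_pos : 0 < r
  r_le_one : r ≤ 1
  le_r : T ≤ (1 - r) * 25.132
  σ_nonneg : 0 ≤ σ
  σ_sq : 4 / (r * 25.132) ^ 2 + 1 / 10000 ≤ σ ^ 2
  κ_nonneg : 0 ≤ κ
  κ_sq : (1 / (48 * r ^ 2) + 1 / 400) / 0.69 ≤ κ ^ 2

section LocalScale

variable {m s : ℕ} {x : Fin s → ℝ} {T r σ κ t : ℝ} {j : Fin s}

theorem IsLocalScale.mul_le_torusDist (h : IsLocalScale T r σ κ) (hm : 0 < m) (hx : Separated m x)
    (ht : m * |t - x j| ≤ T) {k : Fin s} (hk : k ≠ j) :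
    r * torusDist (x k) (x j) ≤ torusDist t (x k) := by
  have hm' : (0 : ℝ) < m := by positivity
  have h1 := torusDist_triangle (x k) t (x j)
  have h2 := torusDist_le_abs t (x j)
  have h3 := hx k j hk
  rw [div_le_iff₀ hm'] at h3
  rw [torusDist_comm (x k) t] at h1
  have h4 : |t - x j| ≤ (1 - r) * torusDist (x k) (x j) := by
    refine le_of_mul_le_mul_left (ht.trans (h.le_r.trans ?_)) hm'
    have := mul_le_mul_of_nonneg_left h3 (sub_nonneg.2 h.r_le_one)
    have h5 : (1 - r) * 25.132 ≤ (1 - r) * (8 * π) := by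
      refine mul_le_mul_of_nonneg_left ?_ (sub_nonneg.2 h.r_le_one)
      have := pi_gt_d4
      norm_num at *; linarith
    linarith
  linarith

theorem IsLocalScale.one_le_decay_mul (h : IsLocalScale T r σ κ) (hm : 0 < m)
    (hx : Separated m x) (ht : m * |t - x j| ≤ T) {k : Fin s} (hk : k ≠ j) :
    1 ≤ decay m r (torusDist (x k) (x j)) * (m * |sin ((t - x k) / 2)|) :=
  MUSIC.one_le_decay_mul hm h.r_pos (lt_of_lt_of_le (by positivity) (hx k j hk))
    (h.mul_le_torusDist hm hx ht hk)

theorem IsLocalScale.norm_residual_zero_le (h : IsLocalScale T r σ κ) (hm : 100 ≤ m)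
    (hx : Separated m x) (ht : m * |t - x j| ≤ T) {d : ℝ} (hd : |dirichlet m (t - x j)| ≤ d) :
    ‖(fourierSubspace m x).starProjection (residual m 0 (x j) t)‖ ≤ (1 + d) * κ := by
  have hm0 : 0 < m := by omega
  refine hx.norm_starProjection_residual_le hm j 0 h.r_pos h.r_le_one zero_le_one h.κ_nonneg h.κ_sq
    (fun k hk => ?_) ?_
  · rw [inner_steering_steeringDeriv_zero, Complex.norm_real, one_mul]
    exact abs_dirichlet_le_of_sin hm0 (h.one_le_decay_mul hm0 hx ht hk)
  · rw [inner_steering_steeringDeriv_zero, Complex.norm_real]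
    exact hd

theorem IsLocalScale.norm_residual_one_le (h : IsLocalScale T r σ κ) (hm : 100 ≤ m)
    (hx : Separated m x) (ht : m * |t - x j| ≤ T) {d : ℝ}
    (hd : |dirichletD m (t - x j)| ≤ m * d) :
    ‖(fourierSubspace m x).starProjection (residual m 1 (x j) t)‖ ≤
      m * (((1 + σ) / 2 + d) * κ) := by
  have hm0 : 0 < m := by omega
  have hσ := h.σ_nonneg
  rw [← mul_assoc, mul_add]
  refine hx.norm_starProjection_residual_le hm j 1 h.r_pos h.r_le_one (by positivity) h.κ_nonneg
    h.κ_sq (fun k hk => ?_) ?_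
  · rw [inner_steering_steeringDeriv_one, Complex.norm_real]
    refine (abs_dirichletD_le_of_sin hm0 (h.one_le_decay_mul hm0 hx ht hk)).trans ?_
    have h1 := decay_le hm h.r_pos (hx k j hk) h.σ_nonneg h.σ_sq
    have h2 := decay_nonneg m r (torusDist (x k) (x j))
    rw [mul_assoc]
    refine mul_le_mul_of_nonneg_left ?_ (by positivity)
    nlinarith
  · rw [inner_steering_steeringDeriv_one, Complex.norm_real]
    exact hd

theorem IsLocalScale.norm_residual_two_le (h : IsLocalScale T r σ κ) (hm : 100 ≤ m)
    (hx : Separated m x) (ht : m * |t - x j| ≤ T) :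
    ‖(fourierSubspace m x).starProjection (residual m 2 (x j) t)‖ ≤
      m ^ 2 * ((1 / 4 + 1 / 40000 + σ * (1 + σ) / 2 + 1 / 12) * κ) := by
  have hm0 : 0 < m := by omega
  have hm' : (100 : ℝ) ≤ m := by exact_mod_cast hm
  have hm2 : (10000 : ℝ) ≤ m ^ 2 := by nlinarith
  have hσ := h.σ_nonneg
  rw [← mul_assoc, mul_add]
  refine hx.norm_starProjection_residual_le hm j 2 h.r_pos h.r_le_one (by positivity) h.κ_nonneg
    h.κ_sq (fun k hk => ?_) ?_
  · rw [inner_steering_steeringDeriv_two, Complex.norm_real]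
    refine (abs_dirichletDD_le_of_sin hm0 (h.one_le_decay_mul hm0 hx ht hk)).trans ?_
    have h1 := decay_le hm h.r_pos (hx k j hk) h.σ_nonneg h.σ_sq
    have h2 := decay_nonneg m r (torusDist (x k) (x j))
    generalize decay m r (torusDist (x k) (x j)) = y at *
    have h3 : y ^ 2 * (1 + y) ≤ σ * (1 + σ) * y := by
      have : y * (1 + y) ≤ σ * (1 + σ) := by nlinarith
      nlinarith
    have h4 := mul_le_mul_of_nonneg_left h3 (by positivity : (0 : ℝ) ≤ m ^ 2)
    have h5 : y ≤ m ^ 2 / 10000 * y := le_mul_of_one_le_left h2 (by linarith)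
    linarith
  · rw [inner_steering_steeringDeriv_two, Complex.norm_real]
    exact (abs_dirichletDD_le hm0 _).trans (le_of_eq (by ring))

/-- The residual vanishes at the node, so close to it the mean value inequality improves on
`IsLocalScale.norm_residual_zero_le`. -/
theorem IsLocalScale.norm_residual_zero_le_near (h : IsLocalScale T r σ κ) (hm : 100 ≤ m)
    (hx : Separated m x) (ht : m * |t - x j| ≤ T) :
    ‖(fourierSubspace m x).starProjection (residual m 0 (x j) t)‖ ≤
      T * (((1 + σ) / 2 + T / 12) * κ) := by
  have hm0 : 0 < m := by omega
  have hm' : (0 : ℝ) < m := by positivity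
  have hσ := h.σ_nonneg
  have hκ := h.κ_nonneg
  have hT : 0 ≤ T := le_trans (by positivity) ht
  set V := fourierSubspace m x
  set C := (((1 + σ) / 2 + T / 12) * κ) with hC
  have hC0 : 0 ≤ C := by positivity
  have hd : ∀ u, HasDerivAt (fun u => V.starProjection (residual m 0 (x j) u))
      (V.starProjection (residual m 1 (x j) u)) u := fun u =>
    (V.starProjection.restrictScalars ℝ).hasFDerivAt.comp_hasDerivAt u
      (hasDerivAt_residual m 0 (x j) u)
  have hball : ∀ u, u ∈ Metric.closedBall (x j) (T / m) ↔ m * |u - x j| ≤ T := fun u => by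
    rw [Metric.mem_closedBall, Real.dist_eq, le_div_iff₀ hm', mul_comm]
  have := (convex_closedBall (x j) (T / m)).norm_image_sub_le_of_norm_hasDerivWithin_le
    (C := m * C) (fun u _ => (hd u).hasDerivWithinAt) (fun u hu => by
      refine h.norm_residual_one_le hm hx ((hball u).1 hu) ?_
      refine (abs_dirichletD_le hm0 _).trans ?_
      have := (hball u).1 hu
      nlinarith)
    ((hball (x j)).2 (by simpa using hT)) ((hball t).2 ht)
  rw [residual_self hm0, map_zero, sub_zero] at this
  refine this.trans ?_
  rw [Real.norm_eq_abs]
  nlinarith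

end LocalScale

/-! ### Perturbation of the subspace -/

section Perturbation

variable {m : ℕ} (V W : Submodule ℂ (EuclideanSpace ℂ (Fin m)))

theorem sinTheta_nonneg : 0 ≤ sinTheta V W := norm_nonneg _

theorem abs_landscape_sub_le (hm : 0 < m) (t : ℝ) :
    |landscape W t - landscape V t| ≤ sinTheta V W := by
  have h := abs_projForm_sub_projForm_le V W (steeringDeriv m 0 t) (steeringDeriv m 0 t)
  rw [landscape_eq, landscape_eq, abs_sub_comm]
  rw [steeringDeriv_zero, norm_steering hm, mul_one, mul_one] at h
  rw [steeringDeriv_zero]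
  convert h using 2
  ring

theorem abs_landscapeD_sub_le (hm : 0 < m) (t : ℝ) :
    |landscapeD W t - landscapeD V t| ≤ 0.5774 * m * sinTheta V W := by
  have h := abs_projForm_sub_projForm_le V W (steeringDeriv m 0 t) (steeringDeriv m 1 t)
  rw [steeringDeriv_zero, norm_steering hm, one_mul] at h
  have h1 := mul_le_mul_of_nonneg_left (norm_steeringDeriv_one_le hm t) (sinTheta_nonneg V W)
  rw [landscapeD, landscapeD, steeringDeriv_zero, neg_sub_neg, ← mul_sub, abs_mul, abs_two,
    abs_sub_comm]
  linarith

theorem abs_landscapeDD_sub_le (hm : 0 < m) (t : ℝ) :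
    |landscapeDD W t - landscapeDD V t| ≤ 0.41 * m ^ 2 * sinTheta V W := by
  have h1 := abs_projForm_sub_projForm_le V W (steeringDeriv m 0 t) (steeringDeriv m 2 t)
  have h2 := abs_projForm_sub_projForm_le V W (steeringDeriv m 1 t) (steeringDeriv m 1 t)
  have hθ := sinTheta_nonneg V W
  rw [steeringDeriv_zero, norm_steering hm, one_mul] at h1
  have e1 := mul_le_mul_of_nonneg_left (norm_steeringDeriv_two_le hm t) hθ
  have e2 := mul_le_mul_of_nonneg_left (norm_steeringDeriv_one_sq_le hm t) hθ
  rw [sq] at e2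
  rw [landscapeDD, landscapeDD, steeringDeriv_zero]
  have h3 := abs_add_le
    (projForm W (steering m t) (steeringDeriv m 2 t) -
      projForm V (steering m t) (steeringDeriv m 2 t))
    (projForm W (steeringDeriv m 1 t) (steeringDeriv m 1 t) -
      projForm V (steeringDeriv m 1 t) (steeringDeriv m 1 t))
  rw [neg_sub_neg, ← mul_sub, abs_mul, abs_two, abs_sub_comm]
  rw [show ∀ a b c d : ℝ, a + b - (c + d) = (b - d) + (a - c) by intros; ring]
  have : 0 ≤ sinTheta V W * (m : ℝ) ^ 2 := by positivity
  linarith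

variable {V W}

theorem landscape_le_sinTheta_sq (hm : 0 < m) {t : ℝ} (ht : steering m t ∈ V) :
    landscape W t ≤ sinTheta V W ^ 2 := by
  have h1 := W.norm_sq_eq_add_norm_sq_starProjection (steering m t)
  rw [Submodule.starProjection_orthogonal_val, norm_steering hm] at h1
  have h2 : landscape W t = ‖steering m t - W.starProjection (steering m t)‖ ^ 2 := by
    rw [landscape]; linarith
  have h3 := (V.starProjection - W.starProjection).le_opNorm (steering m t)
  rw [sub_apply, Submodule.starProjection_eq_self_iff.2 ht, norm_steering hm,
    mul_one] at h3
  rw [h2]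
  exact pow_le_pow_left₀ (norm_nonneg _) h3 2

theorem landscapeD_eq_zero_of_mem (hm : 0 < m) {t : ℝ} (ht : steering m t ∈ V) :
    landscapeD V t = 0 := by
  -- the landscape function is nonnegative and vanishes at `t`
  refine IsLocalMin.hasDerivAt_eq_zero (f := landscape V) (.of_forall fun u => ?_)
    (hasDerivAt_landscape V t)
  have h := V.norm_starProjection_apply_le (steering m u)
  rw [norm_steering hm] at h
  rw [landscape, landscape, Submodule.starProjection_eq_self_iff.2 ht, norm_steering hm]
  nlinarith [norm_nonneg (V.starProjection (steering m u))]

end Perturbation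

/-! ### The perturbed landscape near a node -/

section Node

variable {m s : ℕ} {x : Fin s → ℝ} {W : Submodule ℂ (EuclideanSpace ℂ (Fin m))} {t : ℝ} {j : Fin s}

/-! At each scale `T` the constants are, up to rounding, `r = 1 - T / (8 π)` and the smallest
admissible `σ` and `κ`. -/

theorem isLocalScale_tiny : IsLocalScale 0.1 0.996 0.081 0.185 := by
  constructor <;> norm_num

theorem isLocalScale_small : IsLocalScale 1.12 0.9554 0.084 0.192 := by
  constructor <;> norm_num

theorem isLocalScale_two : IsLocalScale 2 0.9204 0.0872 0.1985 := by
  constructor <;> norm_num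

theorem isLocalScale_medium : IsLocalScale 3.6 0.8567 0.0936 0.212 := by
  constructor <;> norm_num

theorem isLocalScale_large : IsLocalScale 4.27 0.83 0.0966 0.218 := by
  constructor <;> norm_num

/-- The slope of the landscape differs from that of the one-node landscape by the interaction with
the other nodes and by the perturbation of the subspace. -/
theorem abs_landscapeD_add_le (hm : 100 ≤ m) (hθ : subspaceError x W ≤ 0.01) {A B : ℝ}
    (hA : ‖(fourierSubspace m x).starProjection (residual m 0 (x j) t)‖ ≤ A)
    (hB : ‖(fourierSubspace m x).starProjection (residual m 1 (x j) t)‖ ≤ m * B) :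
    |landscapeD W t + 2 * (dirichlet m (t - x j) * dirichletD m (t - x j))| ≤
      m * (2 * A * B + 0.005774) := by
  have hm0 : 0 < m := by omega
  have hm' : (0 : ℝ) < m := by positivity
  have h1 := landscapeD_fourierSubspace hm0 x j t
  have h2 := abs_projForm_le (fourierSubspace m x) (residual m 0 (x j) t) (residual m 1 (x j) t)
  have h3 := mul_le_mul hA hB (norm_nonneg _) ((norm_nonneg _).trans hA)
  have h4 := abs_landscapeD_sub_le (fourierSubspace m x) W hm0 t
  have h5 : 0.5774 * m * sinTheta (fourierSubspace m x) W ≤ 0.5774 * m * 0.01 :=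
    mul_le_mul_of_nonneg_left hθ (by positivity)
  rw [abs_le] at h2 h4 ⊢
  constructor <;> norm_num at * <;> linarith

theorem abs_landscapeD_add_le_of_le_two (hm : 100 ≤ m) (hx : Separated m x)
    (hθ : subspaceError x W ≤ 0.01) (ht : m * |t - x j| ≤ 2) :
    |landscapeD W t + 2 * (dirichlet m (t - x j) * dirichletD m (t - x j))| ≤ m * 0.086 := by
  have hm0 : 0 < m := by omega
  have hm' : (0 : ℝ) < m := by positivity
  have h0 := isLocalScale_two.norm_residual_zero_le_near hm hx ht
  have h1 := isLocalScale_two.norm_residual_one_le hm hx ht (d := 2 / 12)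
    ((abs_dirichletD_le hm0 _).trans (by nlinarith))
  refine (abs_landscapeD_add_le hm hθ h0 h1).trans (mul_le_mul_of_nonneg_left ?_ hm'.le)
  norm_num

theorem abs_landscapeD_add_le_of_le_medium (hm : 100 ≤ m) (hx : Separated m x)
    (hθ : subspaceError x W ≤ 0.01) (ht : m * |t - x j| ≤ 3.6) :
    |landscapeD W t + 2 * (dirichlet m (t - x j) * dirichletD m (t - x j))| ≤ m * 0.1565 := by
  have hm0 : 0 < m := by omega
  have hm' : (0 : ℝ) < m := by positivity
  have h0 := isLocalScale_medium.norm_residual_zero_le hm hx ht (abs_dirichlet_le_one m _)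
  have h1 := isLocalScale_medium.norm_residual_one_le hm hx ht
    ((abs_dirichletD_le_mul hm0 _).trans (mul_comm _ _).le)
  refine (abs_landscapeD_add_le hm hθ h0 h1).trans (mul_le_mul_of_nonneg_left ?_ hm'.le)
  norm_num

theorem torusDist_eq_abs {u v : ℝ} (h : |u - v| ≤ π) : torusDist u v = |u - v| := by
  rw [torusDist, AddCircle.norm_coe_eq_abs_iff _ two_pi_pos.ne', abs_of_pos two_pi_pos]
  linarith

theorem decay_one_le {m : ℕ} (hm : 100 ≤ m) {D T σ : ℝ} (hT : 0 < T) (hD : T ≤ m * D)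
    (hσ0 : 0 ≤ σ) (hσ : 4 / T ^ 2 + 1 / 10000 ≤ σ ^ 2) : decay m 1 D ≤ σ := by
  have hm' : (100 : ℝ) ≤ m := by exact_mod_cast hm
  have hmpos : (0 : ℝ) < m := by positivity
  refine Real.sqrt_le_iff.2 ⟨hσ0, le_trans ?_ hσ⟩
  rw [one_mul, add_div, div_div, ← mul_pow, mul_comm D]
  have h2 : (10000 : ℝ) ≤ m ^ 2 := by nlinarith
  gcongr

theorem abs_landscapeD_add_le_of_le_large (hm : 100 ≤ m) (hx : Separated m x)
    (hθ : subspaceError x W ≤ 0.01) (ht1 : 3.6 ≤ m * |t - x j|) (ht : m * |t - x j| ≤ 4.27) :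
    |landscapeD W t + 2 * (dirichlet m (t - x j) * dirichletD m (t - x j))| ≤ m * 0.131 := by
  have hm0 : 0 < m := by omega
  have hm'' : (100 : ℝ) ≤ m := by exact_mod_cast hm
  have hm' : (0 : ℝ) < m := by positivity
  have hpi : |t - x j| ≤ π := by
    have := pi_gt_three
    have h := mul_le_mul_of_nonneg_right hm'' (abs_nonneg (t - x j))
    norm_num at ht; linarith
  have hpos : 0 < |t - x j| := by
    by_contra hcon
    have : |t - x j| = 0 := le_antisymm (not_lt.1 hcon) (abs_nonneg _)
    rw [this] at ht1; norm_num at ht1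
  have hd : |dirichlet m (t - x j)| ≤ 0.5559 :=
    (abs_dirichlet_le_of_sin hm0 (one_le_decay_mul hm0 one_pos hpos
      (by rw [torusDist_eq_abs hpi, one_mul]))).trans
      (decay_one_le hm (by norm_num) ht1 (by norm_num) (by norm_num))
  have h0 := isLocalScale_large.norm_residual_zero_le hm hx ht hd
  have h1 := isLocalScale_large.norm_residual_one_le hm hx ht
    ((abs_dirichletD_le_mul hm0 _).trans (mul_comm _ _).le)
  refine (abs_landscapeD_add_le hm hθ h0 h1).trans (mul_le_mul_of_nonneg_left ?_ hm'.le)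
  norm_num

theorem dirichlet_neg (m : ℕ) (t : ℝ) : dirichlet m (-t) = dirichlet m t := by
  simp [dirichlet]

theorem dirichletD_neg (m : ℕ) (t : ℝ) : dirichletD m (-t) = -dirichletD m t := by
  simp [dirichletD, neg_div]

/-- The lower bound for the one-node slope exceeds the error `m * e` by `0.0306 m` throughout the
range. The last inequality leaves room for the shift by `0.07 / m` in `abs_landscapeD_le`:
`1 / 6 + 0.125 < 0.292` and `0.292 * 0.07 < 0.0205`. -/
theorem exists_slope_bounds (hm : 100 ≤ m) (hx : Separated m x) (hθ : subspaceError x W ≤ 0.01)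
    (ht1 : 0.97 ≤ m * |t - x j|) (ht : m * |t - x j| ≤ 4.27) :
    ∃ e, |landscapeD W t + 2 * (dirichlet m (t - x j) * dirichletD m (t - x j))| ≤ m * e ∧
      m * (0.0306 + e) ≤ -(2 * (dirichlet m |t - x j| * dirichletD m |t - x j|)) ∧
      e + 0.0205 ≤ 0.125 * (m * |t - x j|) := by
  have hm' : (0 : ℝ) < m := by
    have : 0 < m := by omega
    positivity
  rcases le_total (m * |t - x j|) 2 with h | h
  · refine ⟨0.086, abs_landscapeD_add_le_of_le_two hm hx hθ h,
      le_trans (mul_le_mul_of_nonneg_left ?_ hm'.le) (one_node_slope_near hm ht1 h), ?_⟩ <;>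
      norm_num at * <;> linarith
  rcases le_total (m * |t - x j|) 3.6 with h' | h'
  · refine ⟨0.1565, abs_landscapeD_add_le_of_le_medium hm hx hθ h',
      le_trans (mul_le_mul_of_nonneg_left ?_ hm'.le) (one_node_slope_middle hm h h'), ?_⟩ <;>
      norm_num at * <;> linarith
  · refine ⟨0.131, abs_landscapeD_add_le_of_le_large hm hx hθ h' ht,
      le_trans (mul_le_mul_of_nonneg_left ?_ hm'.le) (one_node_slope_far hm h ht), ?_⟩ <;>
      norm_num at * <;> linarith

theorem le_landscapeD_right (hm : 100 ≤ m) (hx : Separated m x) (hθ : subspaceError x W ≤ 0.01)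
    (ht1 : 0.97 ≤ m * (t - x j)) (ht : m * (t - x j) ≤ 4.27) : 0.0306 * m ≤ landscapeD W t := by
  have h0 : 0 ≤ t - x j := by
    by_contra hcon
    have := mul_nonneg (Nat.cast_nonneg (α := ℝ) m) (neg_nonneg.2 (not_le.1 hcon).le)
    norm_num at *; linarith
  obtain ⟨e, h1, h2, -⟩ := exists_slope_bounds (t := t) (j := j) hm hx hθ
    (by rwa [abs_of_nonneg h0]) (by rwa [abs_of_nonneg h0])
  rw [abs_of_nonneg h0] at h2
  linarith [(abs_le.1 h1).1]

theorem landscapeD_left_le (hm : 100 ≤ m) (hx : Separated m x) (hθ : subspaceError x W ≤ 0.01)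
    (ht1 : 0.97 ≤ m * (x j - t)) (ht : m * (x j - t) ≤ 4.27) :
    landscapeD W t ≤ -(0.0306 * m) := by
  have h0 : 0 ≤ x j - t := by
    by_contra hcon
    have := mul_nonneg (Nat.cast_nonneg (α := ℝ) m) (neg_nonneg.2 (not_le.1 hcon).le)
    norm_num at *; linarith
  obtain ⟨e, h1, h2, -⟩ := exists_slope_bounds (t := t) (j := j) hm hx hθ
    (by rwa [abs_sub_comm, abs_of_nonneg h0]) (by rwa [abs_sub_comm, abs_of_nonneg h0])
  rw [abs_sub_comm, abs_of_nonneg h0, ← neg_sub t, dirichlet_neg, dirichletD_neg] at h2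
  linarith [(abs_le.1 h1).2]

theorem abs_landscapeD_le (hm : 100 ≤ m) (hx : Separated m x) (hθ : subspaceError x W ≤ 0.01)
    (ht1 : 0.97 ≤ m * |t - x j|) (ht : m * |t - x j| ≤ 4.27) :
    |landscapeD W t| ≤ 0.292 * m * (m * |t - x j| - 0.07) := by
  have hm0 : 0 < m := by omega
  have hm' : (0 : ℝ) < m := by positivity
  obtain ⟨e, h1, -, h3⟩ := exists_slope_bounds (t := t) (j := j) hm hx hθ ht1 ht
  have h4 := one_node_slope_le hm0 (t - x j)
  have h5 := mul_le_mul_of_nonneg_left h3 hm'.le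
  have h6 : 0 ≤ m * (m * |t - x j|) := by positivity
  rw [abs_le] at *
  constructor <;> norm_num at * <;> linarith

/-- The curvature of the landscape differs from that of the one-node landscape by the interaction
with the other nodes and by the perturbation of the subspace. -/
theorem IsLocalScale.abs_landscapeDD_add_le {T r σ κ : ℝ} (h : IsLocalScale T r σ κ)
    (hm : 100 ≤ m) (hx : Separated m x) (hθ : subspaceError x W ≤ 0.01)
    (ht : m * |t - x j| ≤ T) :
    |landscapeDD W t + 2 * (dirichlet m (t - x j) * dirichletDD m (t - x j) +
      dirichletD m (t - x j) ^ 2)| ≤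
      m ^ 2 * (2 * ((((1 + σ) / 2 + T / 12) * κ) ^ 2 + T * (((1 + σ) / 2 + T / 12) * κ) *
        ((1 / 4 + 1 / 40000 + σ * (1 + σ) / 2 + 1 / 12) * κ)) + 0.0041) := by
  have hm0 : 0 < m := by omega
  have hm' : (0 : ℝ) < m := by positivity
  have e0 := h.norm_residual_zero_le_near hm hx ht
  have e1 := h.norm_residual_one_le hm hx ht (d := T / 12)
    ((abs_dirichletD_le hm0 _).trans (by nlinarith))
  have e2 := h.norm_residual_two_le hm hx ht
  have h1 := landscapeDD_fourierSubspace hm0 x j t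
  have h2 := abs_projForm_le (fourierSubspace m x) (residual m 0 (x j) t) (residual m 2 (x j) t)
  have h2' := abs_projForm_le (fourierSubspace m x) (residual m 1 (x j) t) (residual m 1 (x j) t)
  have h3 := mul_le_mul e0 e2 (norm_nonneg _) ((norm_nonneg _).trans e0)
  have h3' := mul_le_mul e1 e1 (norm_nonneg _) ((norm_nonneg _).trans e1)
  have h4 := abs_landscapeDD_sub_le (fourierSubspace m x) W hm0 t
  have h5 : 0.41 * m ^ 2 * sinTheta (fourierSubspace m x) W ≤ 0.41 * m ^ 2 * 0.01 :=
    mul_le_mul_of_nonneg_left hθ (by positivity)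
  rw [abs_le] at h2 h2' h4 ⊢
  constructor <;> norm_num at * <;> linarith

theorem landscapeDD_bounds (hm : 100 ≤ m) (hx : Separated m x) (hθ : subspaceError x W ≤ 0.01)
    (ht : m * |t - x j| ≤ 1.12) :
    0.0271 * (m : ℝ) ^ 2 ≤ landscapeDD W t ∧ landscapeDD W t ≤ 0.269 * (m : ℝ) ^ 2 := by
  have h := isLocalScale_small.abs_landscapeDD_add_le hm hx hθ ht
  have h1 := one_node_curvature hm ht (by norm_num)
  have h2 := one_node_curvature_le (m := m) (by omega) (t - x j)
  have h3 : 0 ≤ (m : ℝ) ^ 2 := by positivity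
  rw [abs_le] at h
  constructor <;> norm_num at * <;> linarith

theorem le_landscapeDD_near (hm : 100 ≤ m) (hx : Separated m x) (hθ : subspaceError x W ≤ 0.01)
    (ht : m * |t - x j| ≤ 0.1) : 0.1 * (m : ℝ) ^ 2 ≤ landscapeDD W t := by
  have h := isLocalScale_tiny.abs_landscapeDD_add_le hm hx hθ ht
  have h1 := one_node_curvature hm ht (by norm_num)
  have h3 : 0 ≤ (m : ℝ) ^ 2 := by positivity
  rw [abs_le] at h
  norm_num at *; linarith

end Node

/-! ### The landscape away from the nodes -/

theorem Separated.norm_starProjection_steering_sq_le {m s : ℕ} (hm : 100 ≤ m) {x : Fin s → ℝ}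
    (hx : Separated m x) (j : Fin s) {t r σ : ℝ} (hr : 0 < r)
    (hk : ∀ k, k ≠ j → r * torusDist (x k) (x j) ≤ torusDist t (x k))
    (hj : |dirichlet m (t - x j)| ≤ σ) :
    ‖(fourierSubspace m x).starProjection (steering m t)‖ ^ 2 ≤
      (σ ^ 2 + (1 / (48 * r ^ 2) + 1 / 400)) / 0.69 := by
  have hm0 : 0 < m := by omega
  refine (hx.norm_starProjection_sq_le hm _).trans ?_
  rw [← Finset.add_sum_erase _ _ (Finset.mem_univ j)]
  refine div_le_div_of_nonneg_right (add_le_add ?_ (le_trans (Finset.sum_le_sum fun k hk' => ?_)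
    (hx.sum_decay_sq_le hm j hr))) (by norm_num)
  · rw [inner_steering_steering, Complex.norm_real]
    exact pow_le_pow_left₀ (abs_nonneg _) hj 2
  · rw [inner_steering_steering, Complex.norm_real]
    have hkj := Finset.ne_of_mem_erase hk'
    exact pow_le_pow_left₀ (abs_nonneg _) (abs_dirichlet_le_of_sin hm0
      (one_le_decay_mul hm0 hr (lt_of_lt_of_le (by positivity) (hx k j hkj)) (hk k hkj))) 2

/-- If the nearest node is at distance at most `6 / m`, all others are much farther away; otherwise
the nearest node contributes little and the others are at least half as far from the point as
from the nearest node. -/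
theorem Separated.le_landscape_of_far {m s : ℕ} (hm : 100 ≤ m) {x : Fin s → ℝ}
    (hx : Separated m x) {W : Submodule ℂ (EuclideanSpace ℂ (Fin m))}
    (hθ : subspaceError x W ≤ 0.01) {t : ℝ} (ht : ∀ k, 4.118 ≤ m * torusDist t (x k)) :
    0.529 ≤ landscape W t := by
  have hm0 : 0 < m := by omega
  have hm' : (0 : ℝ) < m := by positivity
  have hpert := (abs_le.1 (abs_landscape_sub_le (fourierSubspace m x) W hm0 t)).1
  suffices h : ‖(fourierSubspace m x).starProjection (steering m t)‖ ^ 2 ≤ 0.46 by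
    have : landscape (fourierSubspace m x) t =
      1 - ‖(fourierSubspace m x).starProjection (steering m t)‖ ^ 2 := rfl
    rw [subspaceError] at hθ
    norm_num at *; linarith
  rcases isEmpty_or_nonempty (Fin s) with hs | hs
  · refine (hx.norm_starProjection_sq_le hm _).trans ?_
    rw [Finset.univ_eq_empty, Finset.sum_empty]; norm_num
  obtain ⟨j, hj⟩ := Finite.exists_min fun k => torusDist t (x k)
  have hpos : 0 < torusDist t (x j) := by
    by_contra hcon
    have := mul_nonneg hm'.le (neg_nonneg.2 (not_lt.1 hcon))
    have := ht j
    norm_num at *; linarith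
  have htri : ∀ k, torusDist (x k) (x j) ≤ torusDist t (x k) + torusDist t (x j) := fun k => by
    rw [torusDist_comm t (x k)]; exact torusDist_triangle _ _ _
  have hdir : ∀ {T σ : ℝ}, 0 < T → T ≤ m * torusDist t (x j) → 0 ≤ σ →
      4 / T ^ 2 + 1 / 10000 ≤ σ ^ 2 → |dirichlet m (t - x j)| ≤ σ := fun hT h hσ0 hσ =>
    (abs_dirichlet_le_of_sin hm0 (one_le_decay_mul hm0 one_pos hpos (one_mul _).le)).trans
      (decay_one_le hm hT h hσ0 hσ)
  rcases le_total (m * torusDist t (x j)) 6 with h6 | h6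
  · refine (hx.norm_starProjection_steering_sq_le hm j (r := 0.761) (by norm_num) (fun k hk => ?_)
      (hdir (σ := 0.486) (by norm_num) (ht j) (by norm_num) (by norm_num))).trans (by norm_num)
    have h1 := hx k j hk
    rw [div_le_iff₀ hm'] at h1
    have h2 : torusDist t (x j) ≤ 0.239 * torusDist (x k) (x j) := by
      refine le_of_mul_le_mul_left (h6.trans ?_) hm'
      have := pi_gt_d4
      norm_num at *; linarith
    have := htri k
    norm_num at *; linarith
  · refine (hx.norm_starProjection_steering_sq_le hm j (r := 1 / 2) (by norm_num) (fun k hk => ?_)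
      (hdir (σ := 0.334) (by norm_num) h6 (by norm_num) (by norm_num))).trans (by norm_num)
    linarith [htri k, hj k]

/-! ### Critical points near the nodes -/

/-- At a node the slope is of size `ϑ m`, and around it the curvature is at least `0.1 m ^ 2`, so
the intermediate value theorem gives a critical point within `7 ϑ / m`. -/
theorem Separated.exists_landscapeD_eq_zero {m s : ℕ} (hm : 100 ≤ m) {x : Fin s → ℝ}
    (hx : Separated m x) {W : Submodule ℂ (EuclideanSpace ℂ (Fin m))}
    (hθ : subspaceError x W ≤ 0.01) (j : Fin s) :
    ∃ y, |y - x j| ≤ 7 * subspaceError x W / m ∧ landscapeD W y = 0 := by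
  have hm0 : 0 < m := by omega
  have hm' : (0 : ℝ) < m := by positivity
  set θ := subspaceError x W with hθdef
  have hθ0 : 0 ≤ θ := norm_nonneg _
  set ρ := 7 * θ / m with hρ
  have hρ0 : 0 ≤ ρ := by positivity
  have hmρ : m * ρ = 7 * θ := by rw [hρ]; field_simp
  have hnode : |landscapeD W (x j)| ≤ 0.5774 * m * θ := by
    have h := abs_landscapeD_sub_le (fourierSubspace m x) W hm0 (x j)
    rwa [landscapeD_eq_zero_of_mem hm0 (steering_mem_fourierSubspace hm0 x j), sub_zero] at h
  have hgrow := (convex_Icc (x j - ρ) (x j + ρ)).mul_sub_le_image_sub_of_le_deriv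
    (f := landscapeD W) (C := 0.1 * (m : ℝ) ^ 2)
    (fun t _ => (hasDerivAt_landscapeD W t).continuousAt.continuousWithinAt)
    (fun t _ => (hasDerivAt_landscapeD W t).differentiableAt.differentiableWithinAt)
    (fun t ht => by
      rw [(hasDerivAt_landscapeD W t).deriv]
      have ht' := interior_subset ht
      refine le_landscapeDD_near hm hx hθ (j := j) ?_
      have : |t - x j| ≤ ρ := by rw [abs_le]; constructor <;> linarith [ht'.1, ht'.2]
      have := mul_le_mul_of_nonneg_left this hm'.le
      norm_num at *; linarith)
  have hx1 : x j ∈ Set.Icc (x j - ρ) (x j + ρ) := ⟨by linarith, by linarith⟩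
  have h1 := hgrow _ hx1 (x j + ρ) ⟨by linarith, le_rfl⟩ (by linarith)
  have h2 := hgrow (x j - ρ) ⟨le_rfl, by linarith⟩ _ hx1 (by linarith)
  have e : 0.1 * (m : ℝ) ^ 2 * ρ = 0.7 * m * θ := by
    rw [sq, ← mul_assoc, mul_assoc, hmρ]; ring
  rw [add_sub_cancel_left, e] at h1
  rw [sub_sub_cancel, e] at h2
  have hmθ : 0 ≤ m * θ := by positivity
  rw [abs_le] at hnode
  have h0 : (0 : ℝ) ∈ Set.Icc (landscapeD W (x j - ρ)) (landscapeD W (x j + ρ)) := by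
    constructor <;> norm_num at * <;> linarith
  obtain ⟨y, hy, hy0⟩ := intermediate_value_Icc (by linarith : x j - ρ ≤ x j + ρ)
    (fun t _ => (hasDerivAt_landscapeD W t).continuousAt.continuousWithinAt) h0
  exact ⟨y, by rw [abs_le]; constructor <;> linarith [hy.1, hy.2], hy0⟩

theorem isLocalMin_landscape {m : ℕ} {W : Submodule ℂ (EuclideanSpace ℂ (Fin m))} {y : ℝ}
    (h1 : landscapeD W y = 0) (h2 : 0 < landscapeDD W y) : IsLocalMin (landscape W) y := by
  refine isLocalMin_of_deriv_deriv_pos ?_ ?_ (hasDerivAt_landscape W y).continuousAt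
  · rwa [deriv_landscape, (hasDerivAt_landscapeD W y).deriv]
  · rwa [deriv_landscape]

theorem landscape_le_of_landscapeDD_nonneg {m : ℕ} {W : Submodule ℂ (EuclideanSpace ℂ (Fin m))}
    {y : ℝ} (hy : IsLocalMin (landscape W) y) {S : Set ℝ} (hS : Convex ℝ S)
    (h : ∀ t ∈ S, 0 ≤ landscapeDD W t) (hyS : y ∈ S) {t : ℝ} (ht : t ∈ S) :
    landscape W y ≤ landscape W t := by
  refine IsMinOn.of_isLocalMinOn_of_convexOn hyS (hy.on S) (convexOn_of_deriv2_nonneg hS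
    (fun t _ => (hasDerivAt_landscape W t).continuousAt.continuousWithinAt)
    (fun t _ => (hasDerivAt_landscape W t).differentiableAt.differentiableWithinAt)
    (fun t _ => ?_) fun t ht => ?_) ht
  · rw [deriv_landscape]
    exact (hasDerivAt_landscapeD W t).differentiableAt.differentiableWithinAt
  · rw [Function.iterate_succ_apply, Function.iterate_one, deriv_landscape,
      (hasDerivAt_landscapeD W t).deriv]
    exact h t (interior_subset ht)

end MUSIC

theorem mainTheorem1 (m s : ℕ) (hm : 100 ≤ m) (x : Fin s → ℝ)
    (hx : ENNReal.ofReal (8 * Real.pi / m) ≤ MUSIC.minSep x)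
    (U : Submodule ℂ (EuclideanSpace ℂ (Fin m))) (hU : Module.finrank ℂ U = s)
    (hϑ : MUSIC.subspaceError x U ≤ 0.01) :
    ∃ y : Fin s → ℝ,
      -- the `y j` are `s` distinct points of the torus
      Function.Injective (fun j => (y j : AddCircle (2 * Real.pi))) ∧
      -- (e), in which no single `j` occurs
      (∀ t : ℝ, (∀ k : Fin s, 4 * Real.pi / (3 * m) < MUSIC.torusDist t (y k)) →
        0.529 ≤ MUSIC.landscape U t) ∧
      -- the remaining parts, for each `j`
      ∀ j : Fin s,
        -- critical points
        HasDerivAt (MUSIC.landscape U) 0 (y j) ∧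
        -- (a)
        |y j - x j| ≤ 7 * MUSIC.subspaceError x U / m ∧
        -- (b)
        (∀ t ∈ Set.Icc (y j - Real.pi / (3 * m)) (y j + Real.pi / (3 * m)),
          0.0271 * (m : ℝ) ^ 2 ≤ iteratedDeriv 2 (MUSIC.landscape U) t ∧
          iteratedDeriv 2 (MUSIC.landscape U) t ≤ 0.269 * (m : ℝ) ^ 2) ∧
        -- (c)
        (IsLocalMin (MUSIC.landscape U) (y j) ∧
          MUSIC.landscape U (y j) ≤ MUSIC.landscape U (x j) ∧
          MUSIC.landscape U (x j) ≤ MUSIC.subspaceError x U ^ 2 ∧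
          MUSIC.subspaceError x U ^ 2 ≤ (10 : ℝ) ^ (-4 : ℤ)) ∧
        -- (d)
        ((∀ t ∈ Set.Icc (y j + Real.pi / (3 * m)) (y j + 4 * Real.pi / (3 * m)),
            0.0306 * (m : ℝ) ≤ deriv (MUSIC.landscape U) t) ∧
          (∀ t ∈ Set.Icc (y j - 4 * Real.pi / (3 * m)) (y j - Real.pi / (3 * m)),
            deriv (MUSIC.landscape U) t ≤ -(0.0306 * (m : ℝ)))) ∧
        -- (f)
        ((∀ t ∈ Set.Icc (y j + Real.pi / (3 * m)) (y j + 4 * Real.pi / (3 * m)),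
            deriv (MUSIC.landscape U) t ≤ 0.292 * (m : ℝ) ^ 2 * |t - y j|) ∧
          (∀ t ∈ Set.Icc (y j - 4 * Real.pi / (3 * m)) (y j - Real.pi / (3 * m)),
            -(0.292 * (m : ℝ) ^ 2 * |t - y j|) ≤ deriv (MUSIC.landscape U) t)) := by
  have hm0 : 0 < m := by omega
  have hm' : (0 : ℝ) < m := by positivity
  have hsep : MUSIC.Separated m x := .of_le_minSep hx
  have hpi1 := Real.pi_gt_d4
  have hpi2 := Real.pi_lt_d4
  choose y hy hy0 using hsep.exists_landscapeD_eq_zero hm hϑ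
  set θ := MUSIC.subspaceError x U with hθ
  have hθ0 : 0 ≤ θ := norm_nonneg _
  have hmy : ∀ j, m * |y j - x j| ≤ 0.07 := fun j => by
    have := hy j
    rw [le_div_iff₀ hm'] at this
    norm_num at hϑ ⊢; linarith
  have hmπ : m * (Real.pi / (3 * m)) = Real.pi / 3 := by field_simp
  have hm4π : m * (4 * Real.pi / (3 * m)) = 4 * Real.pi / 3 := by field_simp
  have hcurv : ∀ j t, m * |t - x j| ≤ 1.12 → 0.0271 * (m : ℝ) ^ 2 ≤ MUSIC.landscapeDD U t ∧
      MUSIC.landscapeDD U t ≤ 0.269 * (m : ℝ) ^ 2 := fun j t ht =>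
    MUSIC.landscapeDD_bounds hm hsep hϑ ht
  have hmpos2 : 0 < 0.0271 * (m : ℝ) ^ 2 := by positivity
  have hlocal : ∀ j, IsLocalMin (MUSIC.landscape U) (y j) := fun j =>
    MUSIC.isLocalMin_landscape (hy0 j)
      (hmpos2.trans_le (hcurv j _ ((hmy j).trans (by norm_num))).1)
  -- as `m |y j - x j| ≤ 0.07`, a point whose scaled distance to `y j` lies in `[π / 3, 4 π / 3]`
  -- has scaled distance to `x j` in `[0.97, 4.27]`
  have hright : ∀ j, ∀ t ∈ Set.Icc (y j + Real.pi / (3 * m)) (y j + 4 * Real.pi / (3 * m)),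
      0.97 ≤ m * (t - x j) ∧ m * (t - x j) ≤ 4.27 ∧
        m * (t - x j) - 0.07 ≤ m * |t - y j| := by
    intro j t ht
    have h1 := hmy j
    have h2 := mul_le_mul_of_nonneg_left (neg_abs_le (y j - x j)) hm'.le
    have h3 := mul_le_mul_of_nonneg_left (le_abs_self (y j - x j)) hm'.le
    have h4 := mul_le_mul_of_nonneg_left ht.1 hm'.le
    have h5 := mul_le_mul_of_nonneg_left ht.2 hm'.le
    have h6 := mul_le_mul_of_nonneg_left (le_abs_self (t - y j)) hm'.le
    rw [mul_add, hmπ] at h4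
    rw [mul_add, hm4π] at h5
    refine ⟨?_, ?_, ?_⟩ <;> norm_num at h1 hpi1 hpi2 ⊢ <;> linarith
  have hleft : ∀ j, ∀ t ∈ Set.Icc (y j - 4 * Real.pi / (3 * m)) (y j - Real.pi / (3 * m)),
      0.97 ≤ m * (x j - t) ∧ m * (x j - t) ≤ 4.27 ∧
        m * (x j - t) - 0.07 ≤ m * |t - y j| := by
    intro j t ht
    have h1 := hmy j
    have h2 := mul_le_mul_of_nonneg_left (neg_abs_le (y j - x j)) hm'.le
    have h3 := mul_le_mul_of_nonneg_left (le_abs_self (y j - x j)) hm'.le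
    have h4 := mul_le_mul_of_nonneg_left ht.1 hm'.le
    have h5 := mul_le_mul_of_nonneg_left ht.2 hm'.le
    have h6 := mul_le_mul_of_nonneg_left (neg_abs_le (t - y j)) hm'.le
    rw [mul_sub, hm4π] at h4
    rw [mul_sub, hmπ] at h5
    refine ⟨?_, ?_, ?_⟩ <;> norm_num at h1 hpi1 hpi2 ⊢ <;> linarith
  have habs : ∀ j t, 0.97 ≤ m * |t - x j| → m * |t - x j| ≤ 4.27 →
      m * |t - x j| - 0.07 ≤ m * |t - y j| →
      |MUSIC.landscapeD U t| ≤ 0.292 * (m : ℝ) ^ 2 * |t - y j| := by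
    intro j t h1 h2 h3
    refine (MUSIC.abs_landscapeD_le hm hsep hϑ h1 h2).trans ?_
    rw [sq, ← mul_assoc, mul_assoc (0.292 * (m : ℝ))]
    exact mul_le_mul_of_nonneg_left h3 (by positivity)
  refine ⟨y, fun j k hjk => ?_, fun t ht => hsep.le_landscape_of_far hm hϑ fun k => ?_,
    fun j => ⟨?_, hy j, fun t ht => ?_, ⟨hlocal j, ?_, ?_, ?_⟩, ⟨fun t ht => ?_, fun t ht => ?_⟩,
      fun t ht => ?_, fun t ht => ?_⟩⟩
  · by_contra hne
    have h0 : MUSIC.torusDist (y j) (y k) = 0 := by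
      simp only at hjk
      rw [MUSIC.torusDist, AddCircle.coe_sub, hjk, sub_self, norm_zero]
    have h1 := MUSIC.torusDist_triangle (x j) (y j) (x k)
    have h2 := MUSIC.torusDist_triangle (y j) (y k) (x k)
    have h3 := MUSIC.torusDist_le_abs (y j) (x j)
    have h4 := MUSIC.torusDist_le_abs (y k) (x k)
    have h5 := hsep j k hne
    rw [div_le_iff₀ hm'] at h5
    rw [MUSIC.torusDist_comm (x j) (y j)] at h1
    have h6 : MUSIC.torusDist (x j) (x k) ≤ |y j - x j| + |y k - x k| := by linarith
    have h7 := mul_le_mul_of_nonneg_right h6 hm'.le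
    have h8 := hmy j
    have h9 := hmy k
    norm_num at h8 h9 hpi1; linarith
  · have h1 := (MUSIC.torusDist_triangle t (x k) (y k))
    rw [MUSIC.torusDist_comm (x k)] at h1
    have h2 := (ht k).le.trans (h1.trans
      (add_le_add_right (MUSIC.torusDist_le_abs (y k) (x k)) _))
    have h3 := mul_le_mul_of_nonneg_left h2 hm'.le
    rw [hm4π, mul_add] at h3
    have h4 := hmy k
    norm_num at h4 hpi1 ⊢; linarith
  · exact (hy0 j) ▸ MUSIC.hasDerivAt_landscape U (y j)
  · rw [MUSIC.iteratedDeriv_two_landscape]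
    refine hcurv j t ?_
    have h1 : |t - y j| ≤ Real.pi / (3 * m) := by
      rw [abs_le]; constructor <;> linarith [ht.1, ht.2]
    have h2 := mul_le_mul_of_nonneg_left ((abs_sub_le t (y j) (x j)).trans
      (add_le_add_left h1 _)) hm'.le
    rw [mul_add, hmπ] at h2
    have h3 := hmy j
    norm_num at h3 hpi2 ⊢; linarith
  · have hball : ∀ u, u ∈ Metric.closedBall (x j) (1 / m) ↔ m * |u - x j| ≤ 1 := fun u => by
      rw [Metric.mem_closedBall, Real.dist_eq, le_div_iff₀ hm', mul_comm]
    refine MUSIC.landscape_le_of_landscapeDD_nonneg (hlocal j) (convex_closedBall (x j) (1 / m))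
      (fun t ht => hmpos2.le.trans (hcurv j t (((hball t).1 ht).trans (by norm_num))).1)
      ((hball _).2 ((hmy j).trans (by norm_num))) ((hball _).2 (by simp))
  · exact MUSIC.landscape_le_sinTheta_sq hm0 (MUSIC.steering_mem_fourierSubspace hm0 x j)
  · calc θ ^ 2 ≤ 0.01 ^ 2 := pow_le_pow_left₀ hθ0 hϑ 2
      _ = (10 : ℝ) ^ (-4 : ℤ) := by norm_num
  · rw [MUSIC.deriv_landscape]
    obtain ⟨h1, h2, -⟩ := hright j t ht
    exact MUSIC.le_landscapeD_right hm hsep hϑ h1 h2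
  · rw [MUSIC.deriv_landscape]
    obtain ⟨h1, h2, -⟩ := hleft j t ht
    exact MUSIC.landscapeD_left_le hm hsep hϑ h1 h2
  · rw [MUSIC.deriv_landscape]
    obtain ⟨h1, h2, h3⟩ := hright j t ht
    have h0 : 0 ≤ t - x j :=
      (pos_of_mul_pos_right (lt_of_lt_of_le (by norm_num) h1) hm'.le).le
    rw [← abs_of_nonneg h0] at h1 h2 h3
    exact (abs_le.1 (habs j t h1 h2 h3)).2
  · rw [MUSIC.deriv_landscape]
    obtain ⟨h1, h2, h3⟩ := hleft j t ht
    have h0 : 0 ≤ x j - t :=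
      (pos_of_mul_pos_right (lt_of_lt_of_le (by norm_num) h1) hm'.le).le
    rw [← abs_of_nonneg h0, abs_sub_comm] at h1 h2 h3
    exact (abs_le.1 (habs j t h1 h2 h3)).1
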